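/- Let $k$ be a field of characteristic $0$. All operads are operads of $k$-vector spaces. **Notation.** For an operad $\mathcal P$ with $\mathcal P(2)$ finite dimensional, $\mathcal P^!$ is its quadratic dual: the operad generated by $\mathcal P(2)^\#\otimes \mathrm{sgn}$ subject to the annihilator of the space of quadratic relations that hold in $\mathcal P(3)$ between the elements of $\mathcal P(2)$. For a non-$\Sigma$ operad $\underline{\mathcal P}$, the non-$\Sigma$ operad $\underline{\mathcal P}^!$ is generated by $\underline{\mathcal P}(2)^\#$ subject to the annihilator of the quadratic relations for the pairing $\langle a\circ_1 b, x\circ_1 y\rangle=a(x)b(y)$, $\langle a\circ_2 b, x\circ_2 y\rangle=-a(x)b(y)$, $\langle a\circ_1 b,x\circ_2y\rangle=\langle a\circ_2 b,x\circ_1y\rangle=0$. The operadic suspension $\mathbf s\mathcal Q$ has $\mathbf s\mathcal Q(n)=\mathcal Q(n)$ placed in degree $n-1$, with actions twisted by the signature and with $f\circ_i g$, $g$ of arity $n$, multiplied by $(-1)^{(i-1)(n-1)}$. The canonical element $\chi\in \mathbf s(\mathcal P\otimes\mathcal P^!)(2)$ is the image of the identity of $\mathcal P(2)$, viewed in $\mathcal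 P(2)\otimes\mathcal P(2)^\#$; $\underline\chi\in\mathbf s(\underline{\mathcal P}\otimes\underline{\mathcal P}^!)(2)$ is defined in the same way. For a $\mathcal P$-algebra $A$ with structure map $\alpha:\mathcal P\to \mathcal End_A$, put $\mathcal Q=\mathbf s(\mathcal End_A\otimes\mathcal P^!)$, let $C^{a-1}_{\mathcal P}(A;A)=\mathcal Q(a)^{\Sigma_a}$, and let $\mathrm{Aver}$ be the averaging projection to invariants. With $m=\mathbf s(\alpha\otimes \mathrm{id})(\chi)$ and $f\circ g=\sum_i f\circ_i g$, the differential is $d f=\mathrm{Aver}(m\circ f-(-1)^{|f|}f\circ m)$. An element $t\in\mathbf s(\mathcal P\otimes\mathcal P^!)(n)$ acts on cochains by $$t(f_1,\dots,f_n)=\mathrm{Aver}\bigl(\mathbf s(\alpha\otimes\mathrm{id})(t)(f_1,\dots,f_n)\bigr),$$ where the composition in $\mathcal Q$ grafts $f_1,\dots,f_n$ in this order. It is a $\delta_{\mathcal P}$-cocycle if for all $\mathcal P$-algebras $A$ and all cochains $$d\,t(f_1,\dots,f_n)=(-1)^{n-1}\sum_{i}(-1)^{|f_1|+\dots+|f_{i-1}|}\,t(f_1,\dots,d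 f_i,\dots,f_n).$$ Let $\mathcal Z_{\mathcal P}\subset\mathbf s(\mathcal P\otimes\mathcal P^!)$ be the collection of all $\delta_{\mathcal P}$-cocycles. **Proposition.** Let $\mathcal P$ be the symmetrization of a non-$\Sigma$ operad $\underline{\mathcal P}$, i.e. $\mathcal P(n)\cong\underline{\mathcal P}(n)\otimes k[\Sigma_n]$ via a morphism $\underline{\mathcal P}\to\mathcal P$ of non-$\Sigma$ operads, and assume that $\mathcal P(2)$ is finite dimensional. View $\mathbf s(\underline{\mathcal P}\otimes\underline{\mathcal P}^!)(2)$ as mapped to $\mathbf s(\mathcal P\otimes\mathcal P^!)(2)$ by the given morphism and by the morphism $\underline{\mathcal P}^!\to\mathcal P^!$ which on generators is dual to the projection of $\mathcal P(2)$ to the summand $\underline{\mathcal P}(2)$ of the identity permutation. Then: 1. $\mathcal Z_{\mathcal P}$ is a suboperad of $\mathbf s(\mathcal P\otimes\mathcal P^!)$, and $\underline\chi,\chi\in\mathcal Z_{\mathcal P}(2)$. 2. There is a unique morphism of operads $A:\mathbf s\mathcal Ass\to\mathcal Z_{\mathcal P}$ with $A(\mathbf s\mu)=\underline\chi$, where $\mu\in\mathcal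 Ass(2)$ is the associative product. 3. There is a unique morphism of operads $L:\mathbf s\mathcal Lie\to\mathcal Z_{\mathcal P}$ with $L(\mathbf s\lambda)=\chi$, where $\lambda\in\mathcal Lie(2)$ is the Lie bracket, and a unique morphism of operads $c:\mathbf s\mathcal Lie\to\mathbf s\mathcal Ass$ with $c(\mathbf s\lambda)=\mathbf s\mu+(\mathbf s\mu)(12)$, the anti-commutator of $\mathbf s\mu$. These satisfy $L=A\circ c$. -/

import Mathlib

/-!
Operads are over a field `k`, ungraded up to suspension: in `Operad k c` the arity `n` component
is placed in degree `c * (n - 1)`; `c = 0` is an ordinary operad, `c = 1` a suspended one.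
Inputs are numbered from `0`. The parity of a degree `n - 1` is written `n + 1`.
-/

universe u

open TensorProduct

/-- Position, in a composition that grafts an operation with `n` inputs at input `i`, of the
input `j ≠ i` of the outer operation. -/
def insSlot (n i j : ℕ) : ℕ := if j < i then j else j + n - 1

/-- `ρ` is the permutation of the inputs of a partial composition at input `i` induced by the
permutation `σ` of the outer inputs and the permutation `τ` of the grafted inputs. -/
def IsBlockPerm {m n r : ℕ} (i : Fin m) (σ : Equiv.Perm (Fin m)) (τ : Equiv.Perm (Fin n))
    (ρ : Equiv.Perm (Fin r)) : Prop :=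
  (∀ (y : Fin n) (p : Fin r), (p : ℕ) = i + y → (ρ p : ℕ) = σ i + τ y) ∧
  ∀ (j : Fin m) (p : Fin r), j ≠ i → (p : ℕ) = insSlot n i j → (ρ p : ℕ) = insSlot n (σ i) (σ j)

theorem exists_shift (n i r : ℕ) (h : n + i ≤ r) : ∃ B : Equiv.Perm (Fin r),
    Equiv.Perm.sign B = (-1) ^ (n * i) ∧
    ∀ x, (B x : ℕ) = if (x : ℕ) < n then x + i else if (x : ℕ) < n + i then x - n else x := by
  by_cases h0 : n + i = 0
  · refine ⟨1, ?_, fun x => ?_⟩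
    · have : n = 0 := by omega
      subst this; simp
    · simp; split_ifs <;> omega
  obtain ⟨L, hL⟩ : ∃ L, n + i = L + 1 := ⟨n + i - 1, by omega⟩
  have hLr : L < r := by omega
  refine ⟨(Fin.cycleRange ⟨L, hLr⟩) ^ i, ?_, ?_⟩
  · rw [map_pow, Fin.sign_cycleRange, ← pow_mul]
    apply neg_one_pow_congr
    simp only [Nat.even_mul]
    have : (n + i) % 2 = (L + 1) % 2 := by rw [hL]
    simp only [Nat.even_iff]; omega
  · have key : ∀ e, e ≤ L + 1 → ∀ x : Fin r, (((Fin.cycleRange ⟨L, hLr⟩) ^ e) x : ℕ) =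
        if (x : ℕ) ≤ L then (if (x : ℕ) + e ≤ L then x + e else x + e - (L + 1)) else x := by
      intro e
      induction e with
      | zero => intro _ x; simp; omega
      | succ e ih =>
        intro he x
        have hr : NeZero r := ⟨by omega⟩
        rw [pow_succ', Equiv.Perm.mul_apply]
        have hx := ih (by omega) x
        set z := ((Fin.cycleRange ⟨L, hLr⟩) ^ e) x
        rcases lt_trichotomy (z : ℕ) L with hz | hz | hz
        · rw [Fin.coe_cycleRange_of_lt (by simpa [Fin.lt_def] using hz)]
          split_ifs at hx ⊢ <;> omega
        · rw [Fin.cycleRange_of_eq (by ext; simpa using hz)]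
          split_ifs at hx ⊢ <;> simp <;> omega
        · rw [Fin.cycleRange_of_gt (by simpa [Fin.lt_def] using hz)]
          split_ifs at hx ⊢ <;> omega
    intro x
    rw [key i (by omega)]
    split_ifs <;> omega

theorem IsBlockPerm.sign_eq {m n r : ℕ} (h : r + 1 = m + n) {i : Fin m}
    {σ : Equiv.Perm (Fin m)} {τ : Equiv.Perm (Fin n)} {ρ : Equiv.Perm (Fin r)}
    (H : IsBlockPerm i σ τ ρ) :
    Equiv.Perm.sign ρ =
      Equiv.Perm.sign σ * Equiv.Perm.sign τ * (-1) ^ ((n + 1) * ((i : ℕ) + (σ i : ℕ))) := by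
  have hi := i.2
  have hi' := (σ i).2
  obtain ⟨m', rfl⟩ : ∃ m', m = m' + 1 := ⟨m - 1, by omega⟩
  obtain rfl : r = n + m' := by omega
  obtain ⟨B, hBs, hB⟩ := exists_shift n i (n + m') (by omega)
  obtain ⟨B', hBs', hB'⟩ := exists_shift n (σ i) (n + m') (by omega)
  obtain ⟨D, hDs, hD⟩ := exists_shift 1 i (m' + 1) (by omega)
  obtain ⟨D', hDs', hD'⟩ := exists_shift 1 (σ i) (m' + 1) (by omega)
  have hD0 : D 0 = i := by ext; rw [hD]; simp
  have hD0' : D' 0 = σ i := by ext; rw [hD']; simp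
  -- the permutation of the remaining inputs
  obtain ⟨p, s, hs⟩ : ∃ p s, D'⁻¹ * σ * D = Equiv.Perm.decomposeFin.symm (p, s) :=
    ⟨_, _, (Equiv.symm_apply_apply Equiv.Perm.decomposeFin _).symm⟩
  have h0 : (D'⁻¹ * σ * D) 0 = 0 := by
    simp only [Equiv.Perm.mul_apply, hD0]; rw [← hD0']; simp
  have hp : p = 0 := by
    have := h0
    rw [hs] at this; simpa using this
  subst hp
  have hσs : Equiv.Perm.sign σ = Equiv.Perm.sign D' * Equiv.Perm.sign s * Equiv.Perm.sign D := by
    have := congrArg Equiv.Perm.sign hs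
    simp only [map_mul, map_inv, Equiv.Perm.decomposeFin.symm_sign, if_true, one_mul] at this
    rw [← this]
    rcases Int.units_eq_one_or (Equiv.Perm.sign D') with h1 | h1 <;>
    rcases Int.units_eq_one_or (Equiv.Perm.sign D) with h2 | h2 <;> simp [h1, h2]
  have hσ : ∀ y : Fin m', σ (D y.succ) = D' (s y).succ := by
    intro y
    have := congrArg (fun f : Equiv.Perm _ => f y.succ) hs
    simp only [Equiv.Perm.mul_apply] at this
    rw [Equiv.Perm.inv_eq_iff_eq] at this
    rw [this]; simp
  have hρ : ρ * B = B' * finSumFinEquiv.permCongr (Equiv.Perm.sumCongr τ s) := by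
    ext x
    obtain ⟨x, rfl⟩ := finSumFinEquiv.surjective x
    simp only [Equiv.Perm.mul_apply, Equiv.permCongr_apply, Equiv.symm_apply_apply]
    rcases x with y | y
    · rw [H.1 y _ (by rw [hB]; simp; omega), hB']
      simp; omega
    · have hne : D y.succ ≠ i := by
        rw [← hD0]; intro hh; exact Fin.succ_ne_zero _ (D.injective hh)
      have hne' : (σ (D y.succ) : ℕ) ≠ σ i := by
        intro hh; exact hne (σ.injective (Fin.ext hh))
      rw [H.2 (D y.succ) _ hne, hσ, hB']
      · have := hD' (s y).succ
        simp only [insSlot, this]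
        simp
        split_ifs <;> omega
      · have hne2 : (D y.succ : ℕ) ≠ i := fun hh => hne (Fin.ext hh)
        have := hD y.succ
        simp only [insSlot, this, hB]
        simp
        split_ifs <;> omega
  have hρs := congrArg Equiv.Perm.sign hρ
  simp only [map_mul, Equiv.Perm.sign_permCongr, Equiv.Perm.sign_sumCongr, hBs, hBs'] at hρs
  rw [hσs, hDs, hDs']
  have e1 : ∀ a : ℕ, ((-1 : ℤˣ) ^ a) * (-1) ^ a = 1 := fun a => by
    rw [← pow_add]; exact Even.neg_one_pow ⟨a, rfl⟩
  have : Equiv.Perm.sign ρ = ((-1) ^ (n * (σ i : ℕ)) *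
      (Equiv.Perm.sign τ * Equiv.Perm.sign s)) * (-1) ^ (n * (i : ℕ)) := by
    rw [← hρs, mul_assoc, e1, mul_one]
  rw [this, show (n + 1) * ((i : ℕ) + (σ i : ℕ)) = n * i + n * (σ i : ℕ) + (i + (σ i : ℕ)) by ring,
    pow_add, pow_add, pow_add, one_mul, one_mul]
  have e2 := e1 (i : ℕ)
  have e3 := e1 (σ i : ℕ)
  generalize ((-1 : ℤˣ) ^ (i : ℕ)) = a at *
  generalize ((-1 : ℤˣ) ^ (σ i : ℕ)) = b at *
  generalize ((-1 : ℤˣ) ^ (n * (i : ℕ))) = c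
  generalize ((-1 : ℤˣ) ^ (n * (σ i : ℕ))) = d
  calc _ = c * d * Equiv.Perm.sign τ * Equiv.Perm.sign s * 1 * 1 := by
        simp only [mul_one]; ac_rfl
    _ = c * d * Equiv.Perm.sign τ * Equiv.Perm.sign s * (a * a) * (b * b) := by rw [e2, e3]
    _ = _ := by ac_rfl

/-- A non-symmetric (non-Σ) unital operad, by partial compositions: `circ h i a b` is
`a ∘ᵢ b`, of arity `r = m + n - 1`. The arity `n` component sits in degree `c * (n - 1)`, whence the
Koszul sign in the parallel associativity axiom. -/
structure NSOperad (k : Type u) [Field k] (c : ℕ) where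
  obj : ℕ → Type u
  [acg : ∀ n, AddCommGroup (obj n)]
  [mod : ∀ n, Module k (obj n)]
  one : obj 1
  circ : ∀ {m n r : ℕ}, r + 1 = m + n → Fin m → obj m →ₗ[k] obj n →ₗ[k] obj r
  one_circ : ∀ {n : ℕ} (h : n + 1 = 1 + n) (x : obj n), circ h 0 one x = x
  circ_one : ∀ {m : ℕ} (h : m + 1 = m + 1) (i : Fin m) (x : obj m), circ h i x one = x
  circ_circ_seq : ∀ {m n l s t r : ℕ} (h₁ : s + 1 = m + n) (h₂ : r + 1 = s + l)
    (h₃ : t + 1 = n + l) (h₄ : r + 1 = m + t) (i : Fin m) (j : Fin n) (p : Fin s),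
    (p : ℕ) = i + j → ∀ (a : obj m) (b : obj n) (d : obj l),
      circ h₂ p (circ h₁ i a b) d = circ h₄ i a (circ h₃ j b d)
  circ_circ_par : ∀ {m n l s t r : ℕ} (h₁ : s + 1 = m + n) (h₂ : r + 1 = s + l)
    (h₃ : t + 1 = m + l) (h₄ : r + 1 = t + n) (i j : Fin m) (p : Fin s) (q : Fin t),
    i < j → (p : ℕ) + 1 = j + n → (q : ℕ) = i → ∀ (a : obj m) (b : obj n) (d : obj l),
      circ h₂ p (circ h₁ i a b) d =
        (-1 : k) ^ (c * ((n + 1) * (l + 1))) • circ h₄ q (circ h₃ j a d) b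

attribute [instance] NSOperad.acg NSOperad.mod

/-- A (symmetric) operad: a non-Σ operad with right actions of the symmetric groups,
`act σ x = x σ`, for which the partial compositions are equivariant. -/
structure Operad (k : Type u) [Field k] (c : ℕ) extends NSOperad k c where
  act : ∀ {n : ℕ}, Equiv.Perm (Fin n) → obj n →ₗ[k] obj n
  act_one : ∀ {n : ℕ} (x : obj n), act 1 x = x
  act_mul : ∀ {n : ℕ} (σ τ : Equiv.Perm (Fin n)) (x : obj n), act (σ * τ) x = act τ (act σ x)
  circ_act : ∀ {m n r : ℕ} (h : r + 1 = m + n) (i : Fin m) (σ : Equiv.Perm (Fin m))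
    (τ : Equiv.Perm (Fin n)) (ρ : Equiv.Perm (Fin r)), IsBlockPerm i σ τ ρ →
    ∀ (a : obj m) (b : obj n),
      circ h i (act σ a) (act τ b) = act ρ (circ h (σ i) a b)

/-- Morphisms of non-Σ operads (degree preserving when `P` and `Q` have the same `c`). -/
@[ext]
structure NSOperad.Hom {k : Type u} [Field k] {c : ℕ} (P Q : NSOperad k c) where
  map : ∀ n : ℕ, P.obj n →ₗ[k] Q.obj n
  map_one : map 1 P.one = Q.one
  map_circ : ∀ {m n r : ℕ} (h : r + 1 = m + n) (i : Fin m) (a : P.obj m) (b : P.obj n),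
    map r (P.circ h i a b) = Q.circ h i (map m a) (map n b)

/-- Morphisms of operads. -/
@[ext]
structure Operad.Hom {k : Type u} [Field k] {c : ℕ} (P Q : Operad k c) extends
    NSOperad.Hom P.toNSOperad Q.toNSOperad where
  map_act : ∀ {n : ℕ} (σ : Equiv.Perm (Fin n)) (a : P.obj n),
    map n (P.act σ a) = Q.act σ (map n a)

/-- Composition of morphisms. -/
def Operad.Hom.comp {k : Type u} [Field k] {c : ℕ} {P Q R : Operad k c}
    (g : Operad.Hom Q R) (f : Operad.Hom P Q) : Operad.Hom P R where
  map n := g.map n ∘ₗ f.map n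
  map_one := by simp [f.map_one, g.map_one]
  map_circ h i a b := by simp [f.map_circ, g.map_circ]
  map_act σ a := by simp [f.map_act, g.map_act]

/-- Suboperads. -/
structure Operad.Suboperad {k : Type u} [Field k] {c : ℕ} (P : Operad k c) where
  carrier : ∀ n : ℕ, Submodule k (P.obj n)
  one_mem : P.one ∈ carrier 1
  circ_mem : ∀ {m n r : ℕ} (h : r + 1 = m + n) (i : Fin m) (a : P.obj m) (b : P.obj n),
    a ∈ carrier m → b ∈ carrier n → P.circ h i a b ∈ carrier r
  act_mem : ∀ {n : ℕ} (σ : Equiv.Perm (Fin n)) (a : P.obj n),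
    a ∈ carrier n → P.act σ a ∈ carrier n

/-- A suboperad, as an operad. -/
def Operad.Suboperad.toOperad {k : Type u} [Field k] {c : ℕ} {P : Operad k c}
    (Z : P.Suboperad) : Operad k c where
  obj n := Z.carrier n
  one := ⟨P.one, Z.one_mem⟩
  circ h i := LinearMap.mk₂ k
    (fun a b => ⟨P.circ h i a b, Z.circ_mem h i a b a.2 b.2⟩)
    (fun a a' b => Subtype.ext (by simp)) (fun s a b => Subtype.ext (by simp))
    (fun a b b' => Subtype.ext (by simp)) (fun s a b => Subtype.ext (by simp))
  one_circ h x := Subtype.ext (P.one_circ h x)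
  circ_one h i x := Subtype.ext (P.circ_one h i x)
  circ_circ_seq h₁ h₂ h₃ h₄ i j p hp a b d :=
    Subtype.ext (P.circ_circ_seq h₁ h₂ h₃ h₄ i j p hp a b d)
  circ_circ_par h₁ h₂ h₃ h₄ i j p q hij hp hq a b d :=
    Subtype.ext (P.circ_circ_par h₁ h₂ h₃ h₄ i j p q hij hp hq a b d)
  act σ := (P.act σ).restrict (fun a ha => Z.act_mem σ a ha)
  act_one x := Subtype.ext (P.act_one x.1)
  act_mul σ τ x := Subtype.ext (P.act_mul σ τ x.1)
  circ_act h i σ τ ρ H a b := Subtype.ext (P.circ_act h i σ τ ρ H a.1 b.1)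

theorem neg_one_pow_eq_of_mod {k : Type u} [Field k] {a b : ℕ} (h : a % 2 = b % 2) :
    (-1 : k) ^ a = (-1) ^ b :=
  neg_one_pow_congr (by simp only [Nat.even_iff]; omega)

/-- The sign of a permutation as a scalar. -/
def signScalar (k : Type u) [Field k] {n : ℕ} (σ : Equiv.Perm (Fin n)) : k :=
  ((Equiv.Perm.sign σ : ℤ) : k)

/-- The operadic suspension: `a ∘ᵢ b` gets the sign `(-1)^((i-1)(n-1))` for `b` of arity `n`
(with `i` counted from `1`). -/
def NSOperad.susp {k : Type u} [Field k] (P : NSOperad k 0) : NSOperad k 1 where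
  obj := P.obj
  one := P.one
  circ {_ n _} h i := (-1 : k) ^ ((i : ℕ) * (n + 1)) • P.circ h i
  one_circ h x := by simp [P.one_circ]
  circ_one h i x := by
    rw [LinearMap.smul_apply, LinearMap.smul_apply, P.circ_one,
      neg_one_pow_eq_of_mod (b := 0) (by omega)]
    simp
  circ_circ_seq {m n l s t r} h₁ h₂ h₃ h₄ i j p hp a b d := by
    simp only [LinearMap.smul_apply, map_smul, smul_smul,
      P.circ_circ_seq h₁ h₂ h₃ h₄ i j p hp a b d]
    congr 1
    rw [← pow_add, ← pow_add]
    apply neg_one_pow_eq_of_mod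
    obtain rfl : t = n + l - 1 := by omega
    obtain ⟨e, he⟩ : ∃ e, n + l = e + 1 := ⟨n + l - 1, by omega⟩
    rw [hp, he, Nat.add_sub_cancel]
    have : (i : ℕ) * (n + 1) + (i : ℕ) * (l + 1) = (i : ℕ) * (e + 1) + 2 * i := by
      rw [← he]; ring
    have h5 : ((i : ℕ) + j) * (l + 1) = i * (l + 1) + j * (l + 1) := by ring
    rw [h5]; omega
  circ_circ_par {m n l s t r} h₁ h₂ h₃ h₄ i j p q hij hp hq a b d := by
    simp only [LinearMap.smul_apply, map_smul, smul_smul,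
      P.circ_circ_par h₁ h₂ h₃ h₄ i j p q hij hp hq a b d]
    congr 1
    rw [zero_mul, pow_zero, mul_one, ← pow_add, ← pow_add, ← pow_add]
    apply neg_one_pow_eq_of_mod
    rw [hq, one_mul]
    have h5 : ((p : ℕ) + 1) * (l + 1) = j * (l + 1) + n * (l + 1) := by rw [hp]; ring
    have h6 : ((p : ℕ) + 1) * (l + 1) = p * (l + 1) + (l + 1) := by ring
    have h7 : (n + 1) * (l + 1) = n * (l + 1) + (l + 1) := by ring
    rw [h7]; omega

theorem susp_act_one {k : Type u} [Field k] (P : Operad k 0) {n : ℕ} (x : P.obj n) :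
    signScalar k (1 : Equiv.Perm (Fin n)) • P.act 1 x = x := by
  simp [signScalar, P.act_one]

theorem susp_act_mul {k : Type u} [Field k] (P : Operad k 0) {n : ℕ}
    (σ τ : Equiv.Perm (Fin n)) (x : P.obj n) :
    signScalar k (σ * τ) • P.act (σ * τ) x =
      signScalar k τ • P.act τ (signScalar k σ • P.act σ x) := by
  rw [P.act_mul, map_smul, smul_smul]
  simp [signScalar, mul_comm]

theorem susp_circ_act {k : Type u} [Field k] (P : Operad k 0) {m n r : ℕ}
    (h : r + 1 = m + n) (i : Fin m) (σ : Equiv.Perm (Fin m)) (τ : Equiv.Perm (Fin n))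
    (ρ : Equiv.Perm (Fin r)) (H : IsBlockPerm i σ τ ρ) (a : P.obj m) (b : P.obj n) :
    (-1 : k) ^ ((i : ℕ) * (n + 1)) •
        P.circ h i (signScalar k σ • P.act σ a) (signScalar k τ • P.act τ b) =
      signScalar k ρ • P.act ρ ((-1 : k) ^ ((σ i : ℕ) * (n + 1)) • P.circ h (σ i) a b) := by
  simp only [LinearMap.smul_apply, map_smul, smul_smul, P.circ_act h i σ τ ρ H]
  congr 1
  simp only [signScalar, H.sign_eq h]
  push_cast
  have h1 : (-1 : k) ^ ((n + 1) * ((i : ℕ) + (σ i : ℕ))) * (-1) ^ ((σ i : ℕ) * (n + 1)) =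
      (-1) ^ ((i : ℕ) * (n + 1)) := by
    rw [← pow_add]
    apply neg_one_pow_eq_of_mod
    rw [show (n + 1) * ((i : ℕ) + (σ i : ℕ)) + (σ i : ℕ) * (n + 1) =
      (i : ℕ) * (n + 1) + 2 * ((σ i : ℕ) * (n + 1)) by ring]
    omega
  rw [← h1]
  ring

/-- The operadic suspension of a symmetric operad; the actions get twisted by the signature. -/
def Operad.susp {k : Type u} [Field k] (P : Operad k 0) : Operad k 1 where
  toNSOperad := P.toNSOperad.susp
  act σ := signScalar k σ • P.act σ
  act_one := susp_act_one P
  act_mul := susp_act_mul P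
  circ_act := susp_circ_act P

/-- The suspension of an element. -/
def Operad.toSusp {k : Type u} [Field k] (P : Operad k 0) {n : ℕ} (x : P.obj n) :
    P.susp.obj n := x

/-- Suspension of morphisms. -/
def NSOperad.Hom.susp {k : Type u} [Field k] {P Q : NSOperad k 0} (f : NSOperad.Hom P Q) :
    NSOperad.Hom P.susp Q.susp where
  map := f.map
  map_one := f.map_one
  map_circ {_ n _} h i a b :=
    (map_smul (f.map _) ((-1 : k) ^ ((i : ℕ) * (n + 1))) (P.circ h i a b)).trans
      (congrArg _ (f.map_circ h i a b))

/-- Suspension of morphisms. -/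
def Operad.Hom.susp {k : Type u} [Field k] {P Q : Operad k 0} (f : Operad.Hom P Q) :
    Operad.Hom P.susp Q.susp where
  toHom := f.toHom.susp
  map_act σ a :=
    (map_smul (f.map _) (signScalar k σ) (P.act σ a)).trans (congrArg _ (f.map_act σ a))

/-- The arity-wise tensor product `P ⊗ Q`. -/
noncomputable def NSOperad.hadamard {k : Type u} [Field k] (P Q : NSOperad k 0) :
    NSOperad k 0 where
  obj n := P.obj n ⊗[k] Q.obj n
  one := P.one ⊗ₜ Q.one
  circ h i := TensorProduct.map₂ (P.circ h i) (Q.circ h i)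
  one_circ h x := by
    induction x with
    | zero => simp only [map_zero]
    | tmul a b => simp only [TensorProduct.map₂_apply_tmul, TensorProduct.map_tmul, P.one_circ,
        Q.one_circ]
    | add a b ha hb => simp only [map_add, ha, hb]
  circ_one h i x := by
    induction x with
    | zero => simp only [map_zero, LinearMap.zero_apply]
    | tmul a b => simp only [TensorProduct.map₂_apply_tmul, TensorProduct.map_tmul, P.circ_one,
        Q.circ_one]
    | add a b ha hb => simp only [map_add, LinearMap.add_apply, ha, hb]
  circ_circ_seq h₁ h₂ h₃ h₄ i j p hp a b d := by
    induction a with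
    | zero => simp only [map_zero, LinearMap.zero_apply]
    | add a a' ha ha' => simp only [map_add, LinearMap.add_apply, ha, ha']
    | tmul a a' =>
    induction b with
    | zero => simp only [map_zero, LinearMap.zero_apply]
    | add a a' ha ha' => simp only [map_add, LinearMap.add_apply, ha, ha']
    | tmul b b' =>
    induction d with
    | zero => simp only [map_zero]
    | add a a' ha ha' => simp only [map_add, ha, ha']
    | tmul d d' =>
      simp only [TensorProduct.map₂_apply_tmul, TensorProduct.map_tmul,
        P.circ_circ_seq h₁ h₂ h₃ h₄ i j p hp, Q.circ_circ_seq h₁ h₂ h₃ h₄ i j p hp]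
  circ_circ_par h₁ h₂ h₃ h₄ i j p q hij hp hq a b d := by
    induction a with
    | zero => simp only [map_zero, LinearMap.zero_apply, smul_zero]
    | add a a' ha ha' => simp only [map_add, LinearMap.add_apply, ha, ha', smul_add]
    | tmul a a' =>
    induction b with
    | zero => simp only [map_zero, LinearMap.zero_apply, smul_zero]
    | add a a' ha ha' => simp only [map_add, LinearMap.add_apply, ha, ha', smul_add]
    | tmul b b' =>
    induction d with
    | zero => simp only [map_zero, LinearMap.zero_apply, smul_zero]
    | add a a' ha ha' => simp only [map_add, LinearMap.add_apply, ha, ha', smul_add]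
    | tmul d d' =>
      simp only [TensorProduct.map₂_apply_tmul, TensorProduct.map_tmul,
        P.circ_circ_par h₁ h₂ h₃ h₄ i j p q hij hp hq,
        Q.circ_circ_par h₁ h₂ h₃ h₄ i j p q hij hp hq, zero_mul, pow_zero, one_smul]

theorem hadamard_act_one {k : Type u} [Field k] (P Q : Operad k 0) {n : ℕ}
    (x : P.obj n ⊗[k] Q.obj n) : TensorProduct.map (P.act 1) (Q.act 1) x = x := by
  induction x with
  | zero => simp only [map_zero]
  | tmul a b => simp only [TensorProduct.map_tmul, P.act_one, Q.act_one]
  | add a b ha hb => simp only [map_add, ha, hb]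

theorem hadamard_act_mul {k : Type u} [Field k] (P Q : Operad k 0) {n : ℕ}
    (σ τ : Equiv.Perm (Fin n)) (x : P.obj n ⊗[k] Q.obj n) :
    TensorProduct.map (P.act (σ * τ)) (Q.act (σ * τ)) x =
      TensorProduct.map (P.act τ) (Q.act τ) (TensorProduct.map (P.act σ) (Q.act σ) x) := by
  induction x with
  | zero => simp only [map_zero]
  | tmul a b => simp only [TensorProduct.map_tmul, P.act_mul, Q.act_mul]
  | add a b ha hb => simp only [map_add, ha, hb]

theorem hadamard_circ_act {k : Type u} [Field k] (P Q : Operad k 0) {m n r : ℕ}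
    (h : r + 1 = m + n) (i : Fin m) (σ : Equiv.Perm (Fin m)) (τ : Equiv.Perm (Fin n))
    (ρ : Equiv.Perm (Fin r)) (H : IsBlockPerm i σ τ ρ)
    (a : P.obj m ⊗[k] Q.obj m) (b : P.obj n ⊗[k] Q.obj n) :
    TensorProduct.map₂ (P.circ h i) (Q.circ h i) (TensorProduct.map (P.act σ) (Q.act σ) a)
        (TensorProduct.map (P.act τ) (Q.act τ) b) =
      TensorProduct.map (P.act ρ) (Q.act ρ)
        (TensorProduct.map₂ (P.circ h (σ i)) (Q.circ h (σ i)) a b) := by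
  induction a with
  | zero => simp only [map_zero, LinearMap.zero_apply]
  | add a a' ha ha' => simp only [map_add, LinearMap.add_apply, ha, ha']
  | tmul a a' =>
  induction b with
  | zero => simp only [map_zero]
  | add a a' ha ha' => simp only [map_add, ha, ha']
  | tmul b b' =>
    simp only [TensorProduct.map₂_apply_tmul, TensorProduct.map_tmul,
      P.circ_act h i σ τ ρ H, Q.circ_act h i σ τ ρ H]

/-- The arity-wise tensor product `P ⊗ Q`, with diagonal actions. -/
noncomputable def Operad.hadamard {k : Type u} [Field k] (P Q : Operad k 0) : Operad k 0 where
  toNSOperad := P.toNSOperad.hadamard Q.toNSOperad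
  act σ := TensorProduct.map (P.act σ) (Q.act σ)
  act_one := hadamard_act_one P Q
  act_mul := hadamard_act_mul P Q
  circ_act := hadamard_circ_act P Q

theorem hadamard_map_circ {k : Type u} [Field k] {P Q : NSOperad k 0}
    (f : NSOperad.Hom P Q) {R S : NSOperad k 0} (g : NSOperad.Hom R S) {m n r : ℕ}
    (h : r + 1 = m + n) (i : Fin m)
    (a : P.obj m ⊗[k] R.obj m) (b : P.obj n ⊗[k] R.obj n) :
    TensorProduct.map (f.map r) (g.map r)
        (TensorProduct.map₂ (P.circ h i) (R.circ h i) a b) =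
      TensorProduct.map₂ (Q.circ h i) (S.circ h i) (TensorProduct.map (f.map m) (g.map m) a)
        (TensorProduct.map (f.map n) (g.map n) b) := by
  induction a with
  | zero => simp only [map_zero, LinearMap.zero_apply]
  | add a a' ha ha' => simp only [map_add, LinearMap.add_apply, ha, ha']
  | tmul a a' =>
  induction b with
  | zero => simp only [map_zero]
  | add a a' ha ha' => simp only [map_add, ha, ha']
  | tmul b b' =>
    simp only [TensorProduct.map₂_apply_tmul, TensorProduct.map_tmul, f.map_circ, g.map_circ]

theorem hadamard_map_act {k : Type u} [Field k] {P Q R S : Operad k 0}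
    (f : Operad.Hom P Q) (g : Operad.Hom R S) {n : ℕ} (σ : Equiv.Perm (Fin n))
    (a : P.obj n ⊗[k] R.obj n) :
    TensorProduct.map (f.map n) (g.map n) (TensorProduct.map (P.act σ) (R.act σ) a) =
      TensorProduct.map (Q.act σ) (S.act σ) (TensorProduct.map (f.map n) (g.map n) a) := by
  induction a with
  | zero => simp only [map_zero]
  | add a a' ha ha' => simp only [map_add, ha, ha']
  | tmul a a' => simp only [TensorProduct.map_tmul, f.map_act, g.map_act]

/-- Tensor product of morphisms. -/
noncomputable def NSOperad.Hom.hadamard {k : Type u} [Field k] {P Q R S : NSOperad k 0}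
    (f : NSOperad.Hom P Q) (g : NSOperad.Hom R S) :
    NSOperad.Hom (P.hadamard R) (Q.hadamard S) where
  map n := TensorProduct.map (f.map n) (g.map n)
  map_one := (TensorProduct.map_tmul _ _ _ _).trans (by rw [f.map_one, g.map_one]; rfl)
  map_circ := hadamard_map_circ f g

/-- Tensor product of morphisms. -/
noncomputable def Operad.Hom.hadamard {k : Type u} [Field k] {P Q R S : Operad k 0}
    (f : Operad.Hom P Q) (g : Operad.Hom R S) :
    Operad.Hom (P.hadamard R) (Q.hadamard S) where
  toHom := f.toHom.hadamard g.toHom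
  map_act := hadamard_map_act f g

/-- The identity morphism. -/
def Operad.Hom.id {k : Type u} [Field k] {c : ℕ} (P : Operad k c) : Operad.Hom P P where
  map _ := LinearMap.id
  map_one := rfl
  map_circ _ _ _ _ := rfl
  map_act _ _ := rfl

section EndOperad

variable {k : Type u} [Field k] {A : Type u} [AddCommGroup A] [Module k A]

/-- The arguments fed to the outer operation of a composition at input `i`. -/
def insArg {m n r : ℕ} (h : r + 1 = m + n) (i : Fin m) (g : (Fin n → A) → A) (x : Fin r → A) :
    Fin m → A := fun j =>
  if h₁ : (j : ℕ) < i then x ⟨j, by omega⟩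
  else if h₂ : (i : ℕ) < j then x ⟨j + n - 1, by omega⟩
  else g fun y => x ⟨i + y, by omega⟩

theorem insArg_update {m n r : ℕ} (h : r + 1 = m + n) (i : Fin m)
    (g : MultilinearMap k (fun _ : Fin n => A) A) (x : Fin r → A) (p : Fin r) :
    (∃ j : Fin m, j ≠ i ∧ ∀ a, insArg h i g (Function.update x p a) =
      Function.update (insArg h i g x) j a) ∨
    (∃ y : Fin n, ∀ a, insArg h i g (Function.update x p a) =
      Function.update (insArg h i g x) i
        (g (Function.update (fun y => x ⟨i + y, by omega⟩) y a))) := by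
  have hi := i.2
  by_cases h1 : (p : ℕ) < i
  · left
    refine ⟨⟨p, by omega⟩, by simp [Fin.ext_iff]; omega, fun a => ?_⟩
    funext j
    simp only [insArg, Function.update_apply, Fin.ext_iff]
    split_ifs <;> first | rfl | omega | skip
    congr 1; funext y
    rw [if_neg (by omega)]
  by_cases h2 : (i : ℕ) + n ≤ p
  · left
    refine ⟨⟨p + 1 - n, by omega⟩, by simp [Fin.ext_iff]; omega, fun a => ?_⟩
    funext j
    simp only [insArg, Function.update_apply, Fin.ext_iff]
    split_ifs <;> first | rfl | omega | skip
    congr 1; funext y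
    rw [if_neg (by omega)]
  · right
    refine ⟨⟨p - i, by omega⟩, fun a => ?_⟩
    funext j
    simp only [insArg, Function.update_apply, Fin.ext_iff]
    split_ifs <;> first | rfl | omega | skip
    congr 1; funext y
    simp only [Function.update_apply, Fin.ext_iff]
    split_ifs <;> first | rfl | omega

/-- Insertion of `g` at input `i` of `f`. -/
def endCirc {m n r : ℕ} (h : r + 1 = m + n) (i : Fin m)
    (f : MultilinearMap k (fun _ : Fin m => A) A) (g : MultilinearMap k (fun _ : Fin n => A) A) :
    MultilinearMap k (fun _ : Fin r => A) A :=
  MultilinearMap.mk' (fun x => f (insArg h i g x))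
    (fun x p a b => by
      rcases insArg_update h i g x p with ⟨j, _, hj⟩ | ⟨y, hy⟩
      · simp only [hj, f.map_update_add]
      · simp only [hy, g.map_update_add, f.map_update_add])
    (fun x p s a => by
      rcases insArg_update h i g x p with ⟨j, _, hj⟩ | ⟨y, hy⟩
      · simp only [hj, f.map_update_smul]
      · simp only [hy, g.map_update_smul, f.map_update_smul])

theorem insArg_eq_update {m n r : ℕ} (h : r + 1 = m + n) (i : Fin m) (g : (Fin n → A) → A)
    (x : Fin r → A) :
    insArg h i g x = Function.update (insArg h i (fun _ => 0) x) i
      (g fun y => x ⟨i + y, by omega⟩) := by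
  funext j
  simp only [insArg, Function.update_apply, Fin.ext_iff]
  split_ifs <;> first | rfl | omega

/-- The endomorphism operad of `A`; an action of an operad `P` on `A`, that is, a `P`-algebra
structure, is a morphism `P → End_A`. -/
def endOperad (k : Type u) [Field k] (A : Type u) [AddCommGroup A] [Module k A] : Operad k 0 where
  obj n := MultilinearMap k (fun _ : Fin n => A) A
  one := MultilinearMap.ofSubsingleton k A A (0 : Fin 1) LinearMap.id
  circ h i := LinearMap.mk₂ k (endCirc h i)
    (fun f f' g => by ext x; rfl)
    (fun s f g => by ext x; rfl)
    (fun f g g' => by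
      ext x
      change f _ = f _ + f _
      rw [insArg_eq_update h i g, insArg_eq_update h i g', insArg_eq_update h i (g + g'),
        ← f.map_update_add]
      rfl)
    (fun s f g => by
      ext x
      change f _ = s • f _
      rw [insArg_eq_update h i g, insArg_eq_update h i (s • g), ← f.map_update_smul]
      rfl)
  one_circ {n} h x := by
    ext v
    change insArg h 0 x v 0 = x v
    change x (fun y => v ⟨0 + y, _⟩) = x v
    congr 1; funext y; congr 1; ext; simp
  circ_one h i x := by
    ext v
    change x _ = x v
    congr 1
    funext j
    simp only [insArg]
    split_ifs with h1 h2
    · rfl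
    · congr 1
    · change v _ = _
      congr 1; ext; simp; omega
  circ_circ_seq h₁ h₂ h₃ h₄ i j p hp a b d := by
    ext v
    change a _ = a _
    congr 1
    funext q
    have hj := j.2
    simp only [insArg]
    split_ifs <;> first | rfl | omega | skip
    · congr 1; ext; simp; omega
    · change b _ = b _
      congr 1
      funext y
      simp only [insArg]
      split_ifs <;> first | rfl | omega | skip
      · congr 1; ext; simp; omega
      · congr 1; funext z; congr 1; ext; simp; omega
  circ_circ_par h₁ h₂ h₃ h₄ i j p q hij hp hq a b d := by
    have hij' : (i : ℕ) < j := hij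
    rw [zero_mul, pow_zero, one_smul]
    ext v
    change a _ = a _
    congr 1
    funext w
    simp only [insArg]
    split_ifs <;> first | rfl | omega | skip
    · congr 1; ext; simp; omega
    · change d _ = d _
      congr 1; funext z
      split_ifs <;> first | omega | skip
      congr 1; ext; simp; omega
    · change b _ = b _
      congr 1; funext z
      split_ifs <;> first | omega | skip
      congr 1; ext; simp; omega
  act σ := (MultilinearMap.domDomCongrLinearEquiv k k A A σ.symm).toLinearMap
  act_one x := by ext v; rfl
  act_mul σ τ x := by ext v; rfl
  circ_act {m n r} h i σ τ ρ H a b := by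
    ext v
    change a _ = a _
    congr 1
    funext w
    obtain ⟨w, rfl⟩ := σ.surjective w
    rw [Equiv.symm_apply_apply]
    by_cases hw : w = i
    · subst hw
      simp only [insArg, lt_irrefl, dite_false]
      change b _ = b _
      congr 1
      funext y
      obtain ⟨y, rfl⟩ := τ.surjective y
      rw [Equiv.symm_apply_apply]
      refine congrArg v ?_
      rw [Equiv.eq_symm_apply]
      ext
      rw [H.1 y _ rfl]
    · have hw1 : (w : ℕ) ≠ i := fun e => hw (Fin.ext e)
      have hw2 : (σ w : ℕ) ≠ σ i := fun e => hw (σ.injective (Fin.ext e))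
      have key := fun p hp => H.2 w p hw hp
      have hwi := w.2
      have hsw := (σ w).2
      have hi := i.2
      have hs := (σ i).2
      have hlt : insSlot n i w < r := by simp only [insSlot]; split_ifs <;> omega
      have hlt' : insSlot n (σ i) (σ w) < r := by simp only [insSlot]; split_ifs <;> omega
      have e1 : ∀ g : (Fin n → A) → A, insArg h i g v w = v ⟨insSlot n i w, hlt⟩ := by
        intro g
        simp only [insArg]
        split_ifs <;> first | omega | (congr 1; ext; simp only [insSlot]; split_ifs; omega)
      have e2 : ∀ (g : (Fin n → A) → A) v, insArg h (σ i) g v (σ w) = v ⟨_, hlt'⟩ := by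
        intro g v
        simp only [insArg]
        split_ifs <;> first | omega | (congr 1; ext; simp only [insSlot]; split_ifs; omega)
      rw [e1, e2]
      congr 1
      rw [Equiv.eq_symm_apply]
      ext
      rw [key _ rfl]

end EndOperad

section Presentations

/-- Formal operadic expressions in binary generators from `G`, with symmetric group actions if
`sym` holds. -/
inductive OpTerm (k G : Type u) (sym : Prop) : ℕ → Type u
  | gen : G → OpTerm k G sym 2
  | one : OpTerm k G sym 1
  | circ {m n r : ℕ} : r + 1 = m + n → Fin m → OpTerm k G sym m → OpTerm k G sym n →
      OpTerm k G sym r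
  | act {n : ℕ} : sym → Equiv.Perm (Fin n) → OpTerm k G sym n → OpTerm k G sym n
  | zero {n : ℕ} : OpTerm k G sym n
  | add {n : ℕ} : OpTerm k G sym n → OpTerm k G sym n → OpTerm k G sym n
  | smul {n : ℕ} : k → OpTerm k G sym n → OpTerm k G sym n

variable {k : Type u} [Field k] {G : Type u} {sym : Prop}

/-- Value of an expression in `Q`, given values of the generators. -/
def OpTerm.eval (Q : NSOperad k 0)
    (ρ : sym → ∀ n : ℕ, Equiv.Perm (Fin n) → Q.obj n →ₗ[k] Q.obj n) (g : G → Q.obj 2) :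
    ∀ {n : ℕ}, OpTerm k G sym n → Q.obj n
  | _, .gen x => g x
  | _, .one => Q.one
  | _, .circ h i a b => Q.circ h i (a.eval Q ρ g) (b.eval Q ρ g)
  | _, .act hs σ a => ρ hs _ σ (a.eval Q ρ g)
  | _, .zero => 0
  | _, .add a b => a.eval Q ρ g + b.eval Q ρ g
  | _, .smul s a => s • a.eval Q ρ g

variable {ι : Type (u + 1)} (Q : ι → NSOperad k 0)
  (ρ : ∀ i, sym → ∀ n : ℕ, Equiv.Perm (Fin n) → (Q i).obj n →ₗ[k] (Q i).obj n)
  (g : ∀ i, G → (Q i).obj 2)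

/-- Two expressions are identified if they have equal values in all models `i`. -/
def termSetoid (n : ℕ) : Setoid (OpTerm k G sym n) where
  r a b := ∀ i, a.eval (Q i) (ρ i) (g i) = b.eval (Q i) (ρ i) (g i)
  iseqv := ⟨fun _ _ => rfl, fun h i => (h i).symm, fun h h' i => (h i).trans (h' i)⟩

/-- Expressions modulo the identities that hold in all models. -/
def PresObj (n : ℕ) : Type u := Quotient (termSetoid Q ρ g n)

variable {Q ρ g}

/-- The class of an expression. -/
def PresObj.mk {n : ℕ} (a : OpTerm k G sym n) : PresObj Q ρ g n := Quotient.mk _ a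

/-- Value of a class in a model. -/
def PresObj.eval (i : ι) {n : ℕ} (a : PresObj Q ρ g n) : (Q i).obj n :=
  Quotient.lift (fun a => OpTerm.eval (Q i) (ρ i) (g i) a)
    (fun a b (h : ∀ i, a.eval (Q i) (ρ i) (g i) = b.eval (Q i) (ρ i) (g i)) => h i) a

theorem PresObj.ext {n : ℕ} {a b : PresObj Q ρ g n}
    (h : ∀ i, a.eval i = b.eval i) : a = b := by
  induction a using Quotient.inductionOn
  induction b using Quotient.inductionOn
  exact Quotient.sound h

/-- Composition of classes. -/
def PresObj.circ {m n r : ℕ} (h : r + 1 = m + n) (i : Fin m) (a : PresObj Q ρ g m)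
    (b : PresObj Q ρ g n) : PresObj Q ρ g r :=
  Quotient.map₂ (OpTerm.circ h i)
    (fun _ _ h₁ _ _ h₂ e => by simp only [OpTerm.eval, h₁ e, h₂ e]) a b

theorem PresObj.eval_circ (e : ι) {m n r : ℕ} (h : r + 1 = m + n) (i : Fin m)
    (a : PresObj Q ρ g m) (b : PresObj Q ρ g n) :
    (PresObj.circ h i a b).eval e = (Q e).circ h i (a.eval e) (b.eval e) := by
  induction a using Quotient.inductionOn
  induction b using Quotient.inductionOn
  rfl

/-- Action on classes. -/
def PresObj.act (hs : sym) {n : ℕ} (σ : Equiv.Perm (Fin n)) (a : PresObj Q ρ g n) :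
    PresObj Q ρ g n :=
  Quotient.map (OpTerm.act hs σ) (fun _ _ h e => by simp only [OpTerm.eval, h e]) a

theorem PresObj.eval_act (e : ι) (hs : sym) {n : ℕ} (σ : Equiv.Perm (Fin n))
    (a : PresObj Q ρ g n) : (PresObj.act hs σ a).eval e = ρ e hs n σ (a.eval e) := by
  induction a using Quotient.inductionOn
  rfl

instance (n : ℕ) : Zero (PresObj Q ρ g n) := ⟨PresObj.mk .zero⟩

instance (n : ℕ) : Add (PresObj Q ρ g n) :=
  ⟨Quotient.map₂ OpTerm.add (fun _ _ h₁ _ _ h₂ e => by simp only [OpTerm.eval, h₁ e, h₂ e])⟩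

instance (n : ℕ) : SMul k (PresObj Q ρ g n) :=
  ⟨fun s => Quotient.map (OpTerm.smul s) (fun _ _ h e => by simp only [OpTerm.eval, h e])⟩

instance (n : ℕ) : Neg (PresObj Q ρ g n) := ⟨fun a => (-1 : k) • a⟩

theorem PresObj.eval_zero (e : ι) (n : ℕ) : (0 : PresObj Q ρ g n).eval e = 0 := rfl

theorem PresObj.eval_add (e : ι) {n : ℕ} (a b : PresObj Q ρ g n) :
    (a + b).eval e = a.eval e + b.eval e := by
  induction a using Quotient.inductionOn
  induction b using Quotient.inductionOn
  rfl

theorem PresObj.eval_smul (e : ι) {n : ℕ} (s : k) (a : PresObj Q ρ g n) :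
    (s • a).eval e = s • a.eval e := by
  induction a using Quotient.inductionOn
  rfl

instance (n : ℕ) : AddCommGroup (PresObj Q ρ g n) where
  add_assoc a b d := PresObj.ext fun e => by simp only [PresObj.eval_add, add_assoc]
  zero_add a := PresObj.ext fun e => by simp only [PresObj.eval_add, PresObj.eval_zero, zero_add]
  add_zero a := PresObj.ext fun e => by simp only [PresObj.eval_add, PresObj.eval_zero, add_zero]
  add_comm a b := PresObj.ext fun e => by simp only [PresObj.eval_add, add_comm]
  neg_add_cancel a := PresObj.ext fun e => by
    change ((-1 : k) • a + a).eval e = _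
    simp [PresObj.eval_add, PresObj.eval_smul, PresObj.eval_zero]
  nsmul := nsmulRec
  zsmul := zsmulRec

instance (n : ℕ) : Module k (PresObj Q ρ g n) where
  one_smul a := PresObj.ext fun e => by simp only [PresObj.eval_smul, one_smul]
  mul_smul s t a := PresObj.ext fun e => by simp only [PresObj.eval_smul, mul_smul]
  smul_zero s := PresObj.ext fun e => by
    simp only [PresObj.eval_smul, PresObj.eval_zero, smul_zero]
  smul_add s a b := PresObj.ext fun e => by
    simp only [PresObj.eval_smul, PresObj.eval_add, smul_add]
  add_smul s t a := PresObj.ext fun e => by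
    simp only [PresObj.eval_smul, PresObj.eval_add, add_smul]
  zero_smul a := PresObj.ext fun e => by
    simp only [PresObj.eval_smul, PresObj.eval_zero, zero_smul]

/-- Action on classes, linearly. -/
def PresObj.actHom (hs : sym) {n : ℕ} (σ : Equiv.Perm (Fin n)) :
    PresObj Q ρ g n →ₗ[k] PresObj Q ρ g n where
  toFun := PresObj.act hs σ
  map_add' a b := PresObj.ext fun e => by simp only [PresObj.eval_act, PresObj.eval_add, map_add]
  map_smul' s a := PresObj.ext fun e => by
    simp only [PresObj.eval_act, PresObj.eval_smul, map_smul, RingHom.id_apply]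

variable (Q ρ g)

/-- The operad of classes of expressions. -/
def presOperad : NSOperad k 0 where
  obj := PresObj Q ρ g
  one := PresObj.mk .one
  circ h i := LinearMap.mk₂ k (PresObj.circ h i)
    (fun a a' b => PresObj.ext fun e => by simp [PresObj.eval_circ, PresObj.eval_add])
    (fun s a b => PresObj.ext fun e => by simp [PresObj.eval_circ, PresObj.eval_smul])
    (fun a b b' => PresObj.ext fun e => by simp [PresObj.eval_circ, PresObj.eval_add])
    (fun s a b => PresObj.ext fun e => by simp [PresObj.eval_circ, PresObj.eval_smul])
  one_circ h x := PresObj.ext fun e =>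
    (PresObj.eval_circ e h 0 (PresObj.mk .one) x).trans ((Q e).one_circ h (x.eval e))
  circ_one h i x := PresObj.ext fun e =>
    (PresObj.eval_circ e h i x (PresObj.mk .one)).trans ((Q e).circ_one h i (x.eval e))
  circ_circ_seq h₁ h₂ h₃ h₄ i j p hp a b d := PresObj.ext fun e => by
    simp only [LinearMap.mk₂_apply, PresObj.eval_circ]
    exact (Q e).circ_circ_seq h₁ h₂ h₃ h₄ i j p hp _ _ _
  circ_circ_par h₁ h₂ h₃ h₄ i j p q hij hp hq a b d := PresObj.ext fun e => by
    simp only [LinearMap.mk₂_apply, PresObj.eval_circ, PresObj.eval_smul]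
    exact (Q e).circ_circ_par h₁ h₂ h₃ h₄ i j p q hij hp hq _ _ _

end Presentations

/-- An operad with a choice of elements `g` of arity two that satisfies the relations `V`. -/
structure NSModel {k : Type u} [Field k] (G : Type u)
    (V : ∀ Q : NSOperad k 0, (G → Q.obj 2) → Prop) : Type (u + 1) where
  Q : NSOperad k 0
  g : G → Q.obj 2
  valid : V Q g

/-- The non-Σ operad presented by binary generators `G` and the relations `V` (which have to be
identities between operadic expressions): the quotient of the free one by the consequences of `V`. -/
def NSOperad.presented {k : Type u} [Field k] (G : Type u)
    (V : ∀ Q : NSOperad k 0, (G → Q.obj 2) → Prop) : NSOperad k 0 :=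
  presOperad (sym := False) (fun M : NSModel G V => M.Q) (fun _ h => h.elim) (fun M => M.g)

/-- An operad with a choice of elements `g` of arity two that satisfies the relations `V`. -/
structure OperadModel {k : Type u} [Field k] (G : Type u)
    (V : ∀ Q : Operad k 0, (G → Q.obj 2) → Prop) : Type (u + 1) where
  Q : Operad k 0
  g : G → Q.obj 2
  valid : V Q g

/-- The operad presented by binary generators `G` and the relations `V`. -/
def Operad.presented {k : Type u} [Field k] (G : Type u)
    (V : ∀ Q : Operad k 0, (G → Q.obj 2) → Prop) : Operad k 0 where
  toNSOperad := presOperad (sym := True) (fun M : OperadModel G V => M.Q.toNSOperad)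
    (fun M _ _ σ => M.Q.act σ) (fun M => M.g)
  act σ := PresObj.actHom trivial σ
  act_one _ := PresObj.ext fun M => (PresObj.eval_act M _ _ _).trans (M.Q.act_one _)
  act_mul σ τ x := PresObj.ext fun M =>
    (PresObj.eval_act M trivial (σ * τ) x).trans <| (M.Q.act_mul σ τ _).trans <|
      (congrArg (M.Q.act τ) (PresObj.eval_act M trivial σ x).symm).trans
        (PresObj.eval_act M trivial τ (PresObj.act trivial σ x)).symm
  circ_act h i σ τ ρ H a b := PresObj.ext fun M =>
    (PresObj.eval_circ M h i (PresObj.act trivial σ a) (PresObj.act trivial τ b)).trans <|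
      (congrArg₂ (fun u v => M.Q.circ h i u v) (PresObj.eval_act M trivial σ a)
        (PresObj.eval_act M trivial τ b)).trans <|
      (M.Q.circ_act h i σ τ ρ H _ _).trans <|
      (congrArg (M.Q.act ρ) (PresObj.eval_circ M h (σ i) a b).symm).trans
        (PresObj.eval_act M trivial ρ (PresObj.circ h (σ i) a b)).symm

/-- A generator. -/
def NSOperad.presentedGen {k : Type u} [Field k] {G : Type u}
    {V : ∀ Q : NSOperad k 0, (G → Q.obj 2) → Prop} (x : G) :
    (NSOperad.presented G V).obj 2 := PresObj.mk (.gen x)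

/-- A generator. -/
def Operad.presentedGen {k : Type u} [Field k] {G : Type u}
    {V : ∀ Q : Operad k 0, (G → Q.obj 2) → Prop} (x : G) :
    (Operad.presented G V).obj 2 := PresObj.mk (.gen x)

/-- The universal property of a presented non-Σ operad. -/
def NSOperad.presentedLift {k : Type u} [Field k] {G : Type u}
    {V : ∀ Q : NSOperad k 0, (G → Q.obj 2) → Prop} (Q : NSOperad k 0) (g : G → Q.obj 2)
    (hg : V Q g) : NSOperad.Hom (NSOperad.presented G V) Q where
  map _ :=
    { toFun := PresObj.eval (⟨Q, g, hg⟩ : NSModel G V)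
      map_add' := PresObj.eval_add (⟨Q, g, hg⟩ : NSModel G V)
      map_smul' := PresObj.eval_smul (⟨Q, g, hg⟩ : NSModel G V) }
  map_one := rfl
  map_circ := PresObj.eval_circ (⟨Q, g, hg⟩ : NSModel G V)

/-- The universal property of a presented operad. -/
def Operad.presentedLift {k : Type u} [Field k] {G : Type u}
    {V : ∀ Q : Operad k 0, (G → Q.obj 2) → Prop} (Q : Operad k 0) (g : G → Q.obj 2)
    (hg : V Q g) : Operad.Hom (Operad.presented G V) Q where
  map _ :=
    { toFun := PresObj.eval (⟨Q, g, hg⟩ : OperadModel G V)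
      map_add' := PresObj.eval_add (⟨Q, g, hg⟩ : OperadModel G V)
      map_smul' := PresObj.eval_smul (⟨Q, g, hg⟩ : OperadModel G V) }
  map_one := rfl
  map_circ := PresObj.eval_circ (⟨Q, g, hg⟩ : OperadModel G V)
  map_act σ a := PresObj.eval_act (⟨Q, g, hg⟩ : OperadModel G V) trivial σ a

/-- Associativity. -/
def assRelation {k : Type u} [Field k] (Q : Operad k 0) (g : PUnit.{u + 1} → Q.obj 2) : Prop :=
  Q.circ (m := 2) (n := 2) (r := 3) rfl 0 (g ⟨⟩) (g ⟨⟩) = Q.circ (m := 2) (n := 2) (r := 3) rfl 1 (g ⟨⟩) (g ⟨⟩)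

/-- The operad for associative algebras. -/
def Ass (k : Type u) [Field k] : Operad k 0 := Operad.presented PUnit.{u + 1} assRelation

/-- The associative product. -/
def Ass.mu (k : Type u) [Field k] : (Ass k).obj 2 := Operad.presentedGen ⟨⟩

/-- Antisymmetry and the Jacobi identity. -/
def lieRelation {k : Type u} [Field k] (Q : Operad k 0) (g : PUnit.{u + 1} → Q.obj 2) : Prop :=
  Q.act (Equiv.swap 0 1) (g ⟨⟩) = -g ⟨⟩ ∧
    ∑ j : Fin 3, Q.act (finRotate 3 ^ (j : ℕ)) (Q.circ (m := 2) (n := 2) (r := 3) rfl 0 (g ⟨⟩) (g ⟨⟩)) = 0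

/-- The operad for Lie algebras. -/
def Lie (k : Type u) [Field k] : Operad k 0 := Operad.presented PUnit.{u + 1} lieRelation

/-- The Lie bracket. -/
def Lie.lam (k : Type u) [Field k] : (Lie k).obj 2 := Operad.presentedGen ⟨⟩

/-- The arity three component of the free non-Σ operad on binary generators `E` is
`(E ⊗ E) ⊕ (E ⊗ E)`, for the compositions at the two inputs; `quadMap` is its map to `Q` induced by
`g`. -/
noncomputable def NSOperad.quadMap {k : Type u} [Field k] {E : Type u} [AddCommGroup E]
    [Module k E] (Q : NSOperad k 0) (g : E →ₗ[k] Q.obj 2) :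
    (E ⊗[k] E) × (E ⊗[k] E) →ₗ[k] Q.obj 3 :=
  (TensorProduct.lift (Q.circ (m := 2) (n := 2) (r := 3) rfl 0) ∘ₗ TensorProduct.map g g).coprod
    (TensorProduct.lift (Q.circ (m := 2) (n := 2) (r := 3) rfl 1) ∘ₗ TensorProduct.map g g)

/-- The arity three component of the free operad on a `Σ₂`-module `E` of binary generators is
the sum of three copies of `E ⊗ E`, the cyclic rotations of the compositions at the first input;
`quadMap` is its map to `Q` induced by `g`. -/
noncomputable def Operad.quadMap {k : Type u} [Field k] {E : Type u} [AddCommGroup E]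
    [Module k E] (Q : Operad k 0) (g : E →ₗ[k] Q.obj 2) :
    (Fin 3 → E ⊗[k] E) →ₗ[k] Q.obj 3 :=
  ∑ j : Fin 3, Q.act (finRotate 3 ^ (j : ℕ)) ∘ₗ
    TensorProduct.lift (Q.circ (m := 2) (n := 2) (r := 3) rfl 0) ∘ₗ TensorProduct.map g g ∘ₗ LinearMap.proj j

/-- The annihilator of the quadratic relations of `P`, for the pairing which is the evaluation
on compositions at the first input and minus the evaluation on those at the second. -/
noncomputable def NSOperad.dualRelations {k : Type u} [Field k] (P : NSOperad k 0) :
    Set ((Module.Dual k (P.obj 2) ⊗[k] Module.Dual k (P.obj 2)) ×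
      (Module.Dual k (P.obj 2) ⊗[k] Module.Dual k (P.obj 2))) :=
  {φ | ∀ r, P.quadMap LinearMap.id r = 0 →
    TensorProduct.dualDistrib k _ _ φ.1 r.1 - TensorProduct.dualDistrib k _ _ φ.2 r.2 = 0}

/-- The annihilator of the quadratic relations of `P`. -/
noncomputable def Operad.dualRelations {k : Type u} [Field k] (P : Operad k 0) :
    Set (Fin 3 → Module.Dual k (P.obj 2) ⊗[k] Module.Dual k (P.obj 2)) :=
  {φ | ∀ r, P.quadMap LinearMap.id r = 0 →
    ∑ j, TensorProduct.dualDistrib k _ _ (φ j) (r j) = 0}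

/-- The relations of the quadratic dual: `g` is linear and kills the annihilator. -/
def NSOperad.IsDualModel {k : Type u} [Field k] (P : NSOperad k 0) (Q : NSOperad k 0)
    (g : Module.Dual k (P.obj 2) → Q.obj 2) : Prop :=
  ∃ f : Module.Dual k (P.obj 2) →ₗ[k] Q.obj 2, (∀ φ, f φ = g φ) ∧
    ∀ φ ∈ P.dualRelations, Q.quadMap f φ = 0

/-- The relations of the quadratic dual: `g` is linear, equivariant for the dual action twisted
by the signature, and kills the annihilator. -/
def Operad.IsDualModel {k : Type u} [Field k] (P : Operad k 0) (Q : Operad k 0)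
    (g : Module.Dual k (P.obj 2) → Q.obj 2) : Prop :=
  ∃ f : Module.Dual k (P.obj 2) →ₗ[k] Q.obj 2, (∀ φ, f φ = g φ) ∧
    (∀ φ, Q.act (Equiv.swap 0 1) (f φ) = -f (φ ∘ₗ P.act (Equiv.swap 0 1))) ∧
    ∀ φ ∈ P.dualRelations, Q.quadMap f φ = 0

/-- The quadratic dual `P^!` of a non-Σ operad, generated by the dual of `P(2)`. -/
noncomputable def NSOperad.quadDual {k : Type u} [Field k] (P : NSOperad k 0) : NSOperad k 0 :=
  NSOperad.presented (Module.Dual k (P.obj 2)) P.IsDualModel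

/-- The quadratic dual `P^!`, generated by the dual of `P(2)` tensored with the signature. -/
noncomputable def Operad.quadDual {k : Type u} [Field k] (P : Operad k 0) : Operad k 0 :=
  Operad.presented (Module.Dual k (P.obj 2)) P.IsDualModel

/-- The generators of the quadratic dual. -/
noncomputable def NSOperad.dualGen {k : Type u} [Field k] (P : NSOperad k 0) :
    Module.Dual k (P.obj 2) →ₗ[k] P.quadDual.obj 2 where
  toFun φ := NSOperad.presentedGen φ
  map_add' φ ψ := PresObj.ext fun M => by
    obtain ⟨f, hf, _⟩ := M.valid
    change M.g (φ + ψ) = M.g φ + M.g ψ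
    simp only [← hf, map_add]
  map_smul' s φ := PresObj.ext fun M => by
    obtain ⟨f, hf, _⟩ := M.valid
    change M.g (s • φ) = s • M.g φ
    simp only [← hf, map_smul]

/-- The generators of the quadratic dual. -/
noncomputable def Operad.dualGen {k : Type u} [Field k] (P : Operad k 0) :
    Module.Dual k (P.obj 2) →ₗ[k] P.quadDual.obj 2 where
  toFun φ := Operad.presentedGen φ
  map_add' φ ψ := PresObj.ext fun M => by
    obtain ⟨f, hf, _⟩ := M.valid
    change M.g (φ + ψ) = M.g φ + M.g ψ
    simp only [← hf, map_add]
  map_smul' s φ := PresObj.ext fun M => by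
    obtain ⟨f, hf, _⟩ := M.valid
    change M.g (s • φ) = s • M.g φ
    simp only [← hf, map_smul]

/-- The canonical element of `s(P ⊗ P^!)(2)`: the image of the identity of `P(2)`, an element
of `P(2) ⊗ P(2)^#`. -/
noncomputable def NSOperad.chi {k : Type u} [Field k] (P : NSOperad k 0)
    [FiniteDimensional k (P.obj 2)] : (P.hadamard P.quadDual).susp.obj 2 :=
  TensorProduct.map LinearMap.id P.dualGen (coevaluation k (P.obj 2) 1)

/-- The canonical element of `s(P ⊗ P^!)(2)`: the image of the identity of `P(2)`, an element
of `P(2) ⊗ P(2)^#`. -/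
noncomputable def Operad.chi {k : Type u} [Field k] (P : Operad k 0)
    [FiniteDimensional k (P.obj 2)] : (P.hadamard P.quadDual).susp.obj 2 :=
  TensorProduct.map LinearMap.id P.dualGen (coevaluation k (P.obj 2) 1)

/-- `P` is the symmetrization of the non-Σ operad `P'` (via `j`): `P(n) = P'(n) ⊗ k[Σₙ]`. -/
def NSOperad.Hom.IsSymmetrization {k : Type u} [Field k] {P' : NSOperad k 0} {P : Operad k 0}
    (j : NSOperad.Hom P' P.toNSOperad) : Prop :=
  ∀ n : ℕ, Function.Bijective fun f : Equiv.Perm (Fin n) → P'.obj n =>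
    ∑ σ, P.act σ (j.map n (f σ))

section Symmetrization

variable {k : Type u} [Field k] {P' : NSOperad k 0} {P : Operad k 0}
  {j : NSOperad.Hom P' P.toNSOperad}

/-- The isomorphism `P'(n) ⊗ k[Σₙ] ≅ P(n)`. -/
noncomputable def symmEquiv (hj : j.IsSymmetrization) (n : ℕ) :
    (Equiv.Perm (Fin n) → P'.obj n) ≃ₗ[k] P.obj n :=
  LinearEquiv.ofBijective
    (∑ σ, P.act σ ∘ₗ j.map n ∘ₗ LinearMap.proj σ) (by
      convert hj n using 2 with f
      simp)

theorem symmEquiv_apply (hj : j.IsSymmetrization) (n : ℕ) (f : Equiv.Perm (Fin n) → P'.obj n) :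
    symmEquiv hj n f = ∑ σ, P.act σ (j.map n (f σ)) := by
  simp [symmEquiv]

/-- The projection of `P(n) = P'(n) ⊗ k[Σₙ]` to the summand of the identity permutation. -/
noncomputable def symmProj (hj : j.IsSymmetrization) (n : ℕ) : P.obj n →ₗ[k] P'.obj n :=
  LinearMap.proj 1 ∘ₗ (symmEquiv hj n).symm.toLinearMap

theorem symmProj_act (hj : j.IsSymmetrization) {n : ℕ} (σ : Equiv.Perm (Fin n)) (x : P'.obj n) :
    symmProj hj n (P.act σ (j.map n x)) = if σ = 1 then x else 0 := by
  have : P.act σ (j.map n x) = symmEquiv hj n (Pi.single σ x) := by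
    rw [symmEquiv_apply, Finset.sum_eq_single σ]
    · simp
    · intro τ _ h; simp [h]
    · simp
  rw [this]
  simp only [symmProj, LinearMap.comp_apply, LinearEquiv.coe_coe, LinearEquiv.symm_apply_apply,
    LinearMap.proj_apply, Pi.single_apply, eq_comm]

theorem perm_two_cases (σ : Equiv.Perm (Fin 2)) : σ = 1 ∨ σ = Equiv.swap 0 1 := by
  revert σ; decide

theorem exists_decomp (hj : j.IsSymmetrization) (v : P.obj 2) : ∃ e₀ e₁ : P'.obj 2,
    v = j.map 2 e₀ + P.act (Equiv.swap 0 1) (j.map 2 e₁) := by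
  obtain ⟨f, rfl⟩ := (symmEquiv hj 2).surjective v
  refine ⟨f 1, f (Equiv.swap 0 1), ?_⟩
  rw [symmEquiv_apply, show (Finset.univ : Finset (Equiv.Perm (Fin 2))) = {1, Equiv.swap 0 1} by
    decide, Finset.sum_pair (by decide), P.act_one]

theorem symmProj_map (hj : j.IsSymmetrization) {n : ℕ} (x : P'.obj n) :
    symmProj hj n (j.map n x) = x := by
  have := symmProj_act hj 1 x
  rwa [P.act_one, if_pos rfl] at this

theorem NSOperad.Hom.IsSymmetrization.finite (hj : j.IsSymmetrization) (n : ℕ)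
    [FiniteDimensional k (P.obj n)] : FiniteDimensional k (P'.obj n) :=
  Module.Finite.of_surjective (symmProj hj n) fun x => ⟨_, symmProj_map hj x⟩

theorem symmProj_comp (hj : j.IsSymmetrization) (v w : P.obj 2) (t : Fin 3) :
    symmProj hj 3 (P.act (finRotate 3 ^ (t : ℕ))
      (P.circ (m := 2) (n := 2) (r := 3) rfl 0 v w)) =
    if t = 0 then P'.circ (m := 2) (n := 2) (r := 3) rfl 0 (symmProj hj 2 v) (symmProj hj 2 w)
    else if t = 2 then P'.circ (m := 2) (n := 2) (r := 3) rfl 1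
      (symmProj hj 2 (P.act (Equiv.swap 0 1) v)) (symmProj hj 2 w)
    else 0 := by
  have key : ∀ (σ τ : Equiv.Perm (Fin 2)) (ρ : Equiv.Perm (Fin 3)), IsBlockPerm 0 σ τ ρ →
      ∀ a b : P'.obj 2, P.circ (m := 2) (n := 2) (r := 3) rfl 0 (P.act σ (j.map 2 a))
        (P.act τ (j.map 2 b)) =
        P.act ρ (j.map 3 (P'.circ (m := 2) (n := 2) (r := 3) rfl (σ 0) a b)) := by
    intro σ τ ρ H a b
    rw [P.circ_act _ 0 σ τ ρ H, j.map_circ]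
  obtain ⟨v₀, v₁, rfl⟩ := exists_decomp hj v
  obtain ⟨w₀, w₁, rfl⟩ := exists_decomp hj w
  have k1 := key 1 1 1 (by unfold IsBlockPerm; decide) v₀ w₀
  have k2 := key 1 (Equiv.swap 0 1) (Equiv.swap 0 1) (by unfold IsBlockPerm; decide) v₀ w₁
  have k3 := key (Equiv.swap 0 1) 1 (finRotate 3) (by unfold IsBlockPerm; decide) v₁ w₀
  have k4 := key (Equiv.swap 0 1) (Equiv.swap 0 1) (Equiv.swap 0 2)
    (by unfold IsBlockPerm; decide) v₁ w₁
  simp only [P.act_one] at k1 k2 k3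
  have n1 : (Equiv.swap 0 1 : Equiv.Perm (Fin 2)) ≠ 1 := by decide
  simp only [map_add, LinearMap.add_apply, k1, k2, k3, k4, ← P.act_mul,
    symmProj_act, symmProj_map, if_neg n1, Equiv.swap_mul_self, P.act_one]
  fin_cases t
  · have e2 : (Equiv.swap 0 1 : Equiv.Perm (Fin 3)) ≠ 1 := by decide
    have e3 : finRotate 3 ≠ 1 := by decide
    have e4 : (Equiv.swap 0 2 : Equiv.Perm (Fin 3)) ≠ 1 := by decide
    simp [e2, e3, e4]
  · have e1 : finRotate 3 ≠ 1 := by decide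
    have e2 : (Equiv.swap 0 1 : Equiv.Perm (Fin 3)) * finRotate 3 ≠ 1 := by decide
    have e3 : finRotate 3 * finRotate 3 ≠ 1 := by decide
    have e4 : (Equiv.swap 0 2 : Equiv.Perm (Fin 3)) * finRotate 3 ≠ 1 := by decide
    simp [e1, e2, e3, e4]
  · have e1 : finRotate 3 ^ 2 ≠ 1 := by decide
    have e2 : (Equiv.swap 0 1 : Equiv.Perm (Fin 3)) * finRotate 3 ^ 2 ≠ 1 := by decide
    have e3 : finRotate 3 * finRotate 3 ^ 2 = 1 := by decide
    have e4 : (Equiv.swap 0 2 : Equiv.Perm (Fin 3)) * finRotate 3 ^ 2 ≠ 1 := by decide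
    simp [e1, e2, e3, e4]

end Symmetrization

theorem Operad.Hom.map_quadMap {k : Type u} [Field k] {E : Type u} [AddCommGroup E] [Module k E]
    {Q R : Operad k 0} (F : Operad.Hom Q R) (g : E →ₗ[k] Q.obj 2) (x : Fin 3 → E ⊗[k] E) :
    F.map 3 (Q.quadMap g x) = R.quadMap (F.map 2 ∘ₗ g) x := by
  have key : ∀ z : E ⊗[k] E,
      F.map 3 (TensorProduct.lift (Q.circ (m := 2) (n := 2) (r := 3) rfl 0)
        (TensorProduct.map g g z)) =
      TensorProduct.lift (R.circ (m := 2) (n := 2) (r := 3) rfl 0)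
        (TensorProduct.map (F.map 2 ∘ₗ g) (F.map 2 ∘ₗ g) z) := by
    intro z
    induction z with
    | zero => simp
    | add a b ha hb => simp only [map_add, ha, hb]
    | tmul a b => simp [F.map_circ]
  simp only [Operad.quadMap, LinearMap.sum_apply, LinearMap.comp_apply, map_sum, F.map_act, key,
    LinearMap.proj_apply]

theorem Operad.quadMap_dualGen {k : Type u} [Field k] (P : Operad k 0) {φ}
    (hφ : φ ∈ P.dualRelations) : P.quadDual.quadMap P.dualGen φ = 0 := by
  refine PresObj.ext fun M => ?_
  obtain ⟨f, hf, _, h⟩ := M.valid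
  have e := (Operad.presentedLift (V := P.IsDualModel) M.Q M.g M.valid).map_quadMap P.dualGen φ
  refine e.trans ?_
  have : ((Operad.presentedLift (V := P.IsDualModel) M.Q M.g M.valid).map 2).comp
      P.dualGen = f := by
    ext φ; exact (hf φ).symm
  rw [this, h φ hφ]
  rfl

theorem Operad.act_dualGen {k : Type u} [Field k] (P : Operad k 0)
    (φ : Module.Dual k (P.obj 2)) :
    P.quadDual.act (Equiv.swap 0 1) (P.dualGen φ) =
      -P.dualGen (φ ∘ₗ P.act (Equiv.swap 0 1)) := by
  rw [← map_neg]
  refine PresObj.ext fun (M : OperadModel _ P.IsDualModel) => ?_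
  obtain ⟨f, hf, h, _⟩ := M.valid
  change M.Q.act (Equiv.swap 0 1) (M.g φ) = M.g (-(φ ∘ₗ P.act (Equiv.swap 0 1)))
  rw [← hf, ← hf, h, map_neg]

theorem Operad.quadMap_apply {k : Type u} [Field k] {E : Type u} [AddCommGroup E] [Module k E]
    (Q : Operad k 0) (g : E →ₗ[k] Q.obj 2) (x : Fin 3 → E ⊗[k] E) :
    Q.quadMap g x = ∑ j : Fin 3, Q.act (finRotate 3 ^ (j : ℕ))
      (TensorProduct.lift (Q.circ (m := 2) (n := 2) (r := 3) rfl 0)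
        (TensorProduct.map g g (x j))) := by
  simp only [Operad.quadMap, LinearMap.sum_apply, LinearMap.comp_apply, LinearMap.proj_apply]

theorem NSOperad.quadMap_apply {k : Type u} [Field k] {E : Type u} [AddCommGroup E] [Module k E]
    (Q : NSOperad k 0) (g : E →ₗ[k] Q.obj 2) (x : (E ⊗[k] E) × (E ⊗[k] E)) :
    Q.quadMap g x =
      TensorProduct.lift (Q.circ (m := 2) (n := 2) (r := 3) rfl 0) (TensorProduct.map g g x.1) +
      TensorProduct.lift (Q.circ (m := 2) (n := 2) (r := 3) rfl 1)
        (TensorProduct.map g g x.2) := by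
  simp only [NSOperad.quadMap, LinearMap.coprod_apply, LinearMap.comp_apply]

section DualEmbedding

variable {k : Type u} [Field k] {P' : NSOperad k 0} {P : Operad k 0}
  {j : NSOperad.Hom P' P.toNSOperad}

theorem quadMap_symmProj (hj : j.IsSymmetrization) (r : Fin 3 → P.obj 2 ⊗[k] P.obj 2) :
    symmProj hj 3 (P.quadMap LinearMap.id r) =
      P'.quadMap LinearMap.id
        (TensorProduct.map (symmProj hj 2) (symmProj hj 2) (r 0),
          TensorProduct.map (symmProj hj 2 ∘ₗ P.act (Equiv.swap 0 1)) (symmProj hj 2) (r 2)) := by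
  have key : ∀ (t : Fin 3) (z : P.obj 2 ⊗[k] P.obj 2),
      symmProj hj 3 (P.act (finRotate 3 ^ (t : ℕ))
        (TensorProduct.lift (P.circ (m := 2) (n := 2) (r := 3) rfl 0) z)) =
      if t = 0 then TensorProduct.lift (P'.circ (m := 2) (n := 2) (r := 3) rfl 0)
          (TensorProduct.map (symmProj hj 2) (symmProj hj 2) z)
      else if t = 2 then TensorProduct.lift (P'.circ (m := 2) (n := 2) (r := 3) rfl 1)
        (TensorProduct.map (symmProj hj 2 ∘ₗ P.act (Equiv.swap 0 1)) (symmProj hj 2) z)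
      else 0 := by
    intro t z
    induction z with
    | zero => simp
    | add a b ha hb =>
      simp only [map_add, ha, hb]
      split_ifs <;> simp
    | tmul a b =>
      simp only [TensorProduct.lift.tmul, TensorProduct.map_tmul, LinearMap.comp_apply,
        symmProj_comp]
  rw [Operad.quadMap_apply, NSOperad.quadMap_apply, map_sum]
  simp only [TensorProduct.map_id, LinearMap.id_apply, key]
  simp [Fin.sum_univ_three]

theorem dualEmbedding_aux (hj : j.IsSymmetrization)
    {φ} (hφ : φ ∈ P'.dualRelations) :
    P.quadDual.toNSOperad.quadMap (P.dualGen ∘ₗ (symmProj hj 2).dualMap) φ = 0 := by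
  set p := symmProj hj 2 with hp
  set D := p.dualMap with hD
  set D' := (p ∘ₗ P.act (Equiv.swap 0 1)).dualMap with hD'
  let Φ : Fin 3 → Module.Dual k (P.obj 2) ⊗[k] Module.Dual k (P.obj 2) :=
    ![TensorProduct.map D D φ.1, 0, (-1 : k) • TensorProduct.map D' D φ.2]
  have hdd : ∀ (a b : P.obj 2 →ₗ[k] P'.obj 2) (ψ : Module.Dual k (P'.obj 2) ⊗[k] Module.Dual k (P'.obj 2))
      (z : P.obj 2 ⊗[k] P.obj 2),
      TensorProduct.dualDistrib k _ _ (TensorProduct.map a.dualMap b.dualMap ψ) z =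
      TensorProduct.dualDistrib k _ _ ψ (TensorProduct.map a b z) := by
    intro a b ψ z
    induction ψ with
    | zero => simp
    | add x y hx hy => simp only [map_add, LinearMap.add_apply, hx, hy]
    | tmul x y =>
    induction z with
    | zero => simp
    | add x y hx hy => simp only [map_add, hx, hy]
    | tmul u v => simp
  have hΦ : Φ ∈ P.dualRelations := by
    intro r hr
    have h1 := quadMap_symmProj hj r
    rw [hr, map_zero] at h1
    have h2 := hφ _ h1.symm
    dsimp only at h2
    rw [← hp] at h2
    simp only [Fin.sum_univ_three, Φ, Matrix.cons_val_zero, Matrix.cons_val_one, Matrix.cons_val,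
      map_zero, map_smul, LinearMap.zero_apply, LinearMap.smul_apply, hD, hD', hdd, smul_eq_mul]
    linear_combination h2
  have h0 := P.quadMap_dualGen hΦ
  rw [← h0]
  have hblock : IsBlockPerm (m := 2) (n := 2) (r := 3) 1 (Equiv.swap 0 1) 1 (finRotate 3 ^ 2) := by
    unfold IsBlockPerm; decide
  have key : ∀ z : Module.Dual k (P'.obj 2) ⊗[k] Module.Dual k (P'.obj 2),
      TensorProduct.lift (P.quadDual.circ (m := 2) (n := 2) (r := 3) rfl 1)
        (TensorProduct.map (P.dualGen ∘ₗ D) (P.dualGen ∘ₗ D) z) =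
      P.quadDual.act (finRotate 3 ^ 2)
        (TensorProduct.lift (P.quadDual.circ (m := 2) (n := 2) (r := 3) rfl 0)
          (TensorProduct.map P.dualGen P.dualGen ((-1 : k) • TensorProduct.map D' D z))) := by
    intro z
    induction z with
    | zero => simp
    | add a b ha hb => simp only [map_add, ha, hb, smul_add]
    | tmul a b =>
      have e := P.quadDual.circ_act (m := 2) (n := 2) (r := 3) rfl 1 (Equiv.swap 0 1) 1 _ hblock
        (-P.dualGen (D' a)) (P.dualGen (D b))
      have e2 : P.quadDual.act (Equiv.swap 0 1) (-P.dualGen (D' a)) = P.dualGen (D a) := by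
        rw [map_neg, P.act_dualGen, neg_neg]
        congr 1
        ext v
        simp only [hD, hD', LinearMap.dualMap_apply, LinearMap.comp_apply]
        rw [← P.act_mul, Equiv.swap_mul_self, P.act_one]
      rw [e2, P.quadDual.act_one, show (Equiv.swap 0 1 : Equiv.Perm (Fin 2)) 1 = 0 by decide] at e
      simp only [TensorProduct.map_tmul, LinearMap.comp_apply, TensorProduct.lift.tmul, e, map_smul,
        ← neg_one_smul k (P.dualGen (D' a)), LinearMap.smul_apply]
  have key0 : ∀ z : Module.Dual k (P'.obj 2) ⊗[k] Module.Dual k (P'.obj 2),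
      TensorProduct.map (P.dualGen ∘ₗ D) (P.dualGen ∘ₗ D) z =
      TensorProduct.map P.dualGen P.dualGen (TensorProduct.map D D z) := by
    intro z
    rw [TensorProduct.map_comp]; rfl
  rw [NSOperad.quadMap_apply, Operad.quadMap_apply, key φ.2, key0 φ.1, Fin.sum_univ_three]
  simp [Φ, P.quadDual.act_one]

/-- The inclusion of `P'^!` into `P^!`, which on generators is dual to the projection of `P(2)`
to `P'(2)`. -/
noncomputable def dualEmbedding (hj : j.IsSymmetrization) :
    NSOperad.Hom P'.quadDual P.quadDual.toNSOperad :=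
  NSOperad.presentedLift P.quadDual.toNSOperad (fun φ => P.dualGen (φ ∘ₗ symmProj hj 2))
    ⟨P.dualGen ∘ₗ (symmProj hj 2).dualMap, fun _ => rfl, fun _ hφ => dualEmbedding_aux hj hφ⟩

/-- The canonical element of `s(P' ⊗ P'^!)(2)`, viewed as an element of `s(P ⊗ P^!)(2)`. -/
noncomputable def nsChi [FiniteDimensional k (P.obj 2)] (hj : j.IsSymmetrization) :
    (P.hadamard P.quadDual).susp.obj 2 :=
  haveI := hj.finite 2
  (j.hadamard (dualEmbedding hj)).susp.map 2 P'.chi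

end DualEmbedding

section Cochains

variable {k : Type u} [Field k]

/-- The invariants of the symmetric group action. -/
def Operad.invariants {c : ℕ} (Q : Operad k c) (n : ℕ) : Submodule k (Q.obj n) where
  carrier := {x | ∀ σ, Q.act σ x = x}
  zero_mem' _ := map_zero _
  add_mem' ha hb σ := by rw [map_add, ha σ, hb σ]
  smul_mem' s _ ha σ := by rw [map_smul, ha σ]

theorem Operad.act_sum_act {c : ℕ} (Q : Operad k c) {n : ℕ} (τ : Equiv.Perm (Fin n))
    (x : Q.obj n) : Q.act τ (∑ σ, Q.act σ x) = ∑ σ, Q.act σ x := by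
  rw [map_sum]
  simp only [← Q.act_mul]
  exact Fintype.sum_equiv (Equiv.mulRight τ) _ _ fun _ => rfl

/-- The averaging projection to the invariants. -/
noncomputable def Operad.aver {c : ℕ} (Q : Operad k c) (n : ℕ) : Q.obj n →ₗ[k] Q.invariants n :=
  LinearMap.codRestrict (Q.invariants n)
    ((Fintype.card (Equiv.Perm (Fin n)) : k)⁻¹ • ∑ σ, Q.act σ) fun x τ => by
      simp only [LinearMap.smul_apply, LinearMap.sum_apply, map_smul, Q.act_sum_act]

/-- The sum of all `f ∘ᵢ g`. -/
def Operad.preLie {c : ℕ} (Q : Operad k c) {m n r : ℕ} (h : r + 1 = m + n) (f : Q.obj m)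
    (g : Q.obj n) : Q.obj r :=
  ∑ i, Q.circ h i f g

/-- Composition of `fs` into the inputs `p, …, p + q - 1` of `x`, from left to right, the first
`p` inputs being done. -/
def Operad.gammaAux {c : ℕ} (Q : Operad k c) : ∀ (q p s r : ℕ), s = p + q → Q.obj s →
    ∀ fs : Fin q → Σ a, Q.obj a, p + ∑ i, (fs i).1 = r → Q.obj r
  | 0, p, s, r, hs, x, fs, h =>
      (show s = r by rw [Fin.sum_univ_zero] at h; omega) ▸ x
  | q + 1, p, s, r, hs, x, fs, h =>
      Q.gammaAux q (p + (fs 0).1) (p + (fs 0).1 + q) r rfl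
        (Q.circ (by omega) ⟨p, by omega⟩ x (fs 0).2) (fun i => fs i.succ)
        (by rw [Fin.sum_univ_succ] at h; omega)

/-- The full composition `x(f₁, …, fₙ)`, with `f₁` grafted first. -/
def Operad.gamma {c : ℕ} (Q : Operad k c) {n r : ℕ} (x : Q.obj n) (fs : Fin n → Σ a, Q.obj a)
    (h : ∑ i, (fs i).1 = r) : Q.obj r :=
  Q.gammaAux n 0 n r (by omega) x fs (by omega)

/-- Operations with `n` arguments on the invariants of `Q`, with result of arity the sum of the
arities of the arguments. The degree of arity `a` being `a - 1`, these operations have degree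
`n - 1`. -/
def Operad.CochainOp {c : ℕ} (Q : Operad k c) (n : ℕ) : Type u :=
  ∀ (fs : Fin n → Σ a, Q.invariants a) (r : ℕ), ∑ i, (fs i).1 = r → Q.invariants r

/-- The operation `Aver (t(f₁, …, fₙ))` on invariants. -/
noncomputable def Operad.cup {c : ℕ} (Q : Operad k c) {n : ℕ} (t : Q.obj n) : Q.CochainOp n :=
  fun fs r h => Q.aver r (Q.gamma t (fun i => ⟨(fs i).1, (fs i).2.1⟩) h)

/-- The differential `[m, f] = m ∘ f - (-1)^|f| f ∘ m` on invariants, for `m` of degree one. -/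
noncomputable def Operad.cochainD {c : ℕ} (Q : Operad k c) (m : Q.obj 2) {a : ℕ}
    (f : Q.invariants a) : Q.invariants (a + 1) :=
  Q.aver (a + 1) (Q.preLie (m := 2) (n := a) (by omega) m f.1 -
    (-1 : k) ^ (a + 1) • Q.preLie (m := a) (n := 2) rfl f.1 m)

theorem sum_update_succ {n : ℕ} {X : ℕ → Type u} (fs : Fin n → Σ a, X a) (i : Fin n)
    (x : X ((fs i).1 + 1)) {r : ℕ} (h : ∑ j, (fs j).1 = r) :
    ∑ j, (Function.update fs i (⟨(fs i).1 + 1, x⟩ : Σ a, X a) j).1 = r + 1 := by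
  rw [← Finset.add_sum_erase _ _ (Finset.mem_univ i), Function.update_self,
    Finset.sum_congr rfl (g := fun j => (fs j).1), ← h,
    ← Finset.add_sum_erase _ _ (Finset.mem_univ i)]
  · simp only; omega
  · intro j hj
    rw [Function.update_of_ne (Finset.ne_of_mem_erase hj)]

/-- The differential of an operation `U` of degree `n - 1`, as a map in the degree `|fᵢ| = aᵢ - 1`:
`d U(f₁, …, fₙ) - (-1)^(n-1) ∑ᵢ (-1)^(|f₁| + … + |fᵢ₋₁|) U(f₁, …, d fᵢ, …, fₙ)`. -/
noncomputable def Operad.opDelta {c : ℕ} (Q : Operad k c) (m : Q.obj 2) {n : ℕ}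
    (U : Q.CochainOp n) (fs : Fin n → Σ a, Q.invariants a) (r : ℕ) (h : ∑ i, (fs i).1 = r) :
    Q.invariants (r + 1) :=
  Q.cochainD m (U fs r h) - (-1 : k) ^ (n + 1) • ∑ i,
    (-1 : k) ^ (∑ j with j < i, ((fs j).1 + 1)) •
      U (Function.update fs i ⟨(fs i).1 + 1, Q.cochainD m (fs i).2⟩) (r + 1)
        (sum_update_succ fs i _ h)

/-- `s(End_A ⊗ P^!)`. Its invariants of arity `a` are the cochains of `C_P(A; A)` of degree
`a - 1`. -/
noncomputable def coeffOperad (A : Type u) [AddCommGroup A] [Module k A] (P : Operad k 0) :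
    Operad k 1 :=
  ((endOperad k A).hadamard P.quadDual).susp

/-- The map `s(P ⊗ P^!) → s(End_A ⊗ P^!)` given by a `P`-algebra structure on `A`. -/
noncomputable def algMap {A : Type u} [AddCommGroup A] [Module k A] {P : Operad k 0}
    (α : Operad.Hom P (endOperad k A)) :
    Operad.Hom (P.hadamard P.quadDual).susp (coeffOperad A P) :=
  (α.hadamard (Operad.Hom.id P.quadDual)).susp

/-- The cup operation given by `t` is closed on the cochains of all `P`-algebras, whose
differential is the bracket with the image of `χ`. -/
def Operad.IsCocycle (P : Operad k 0) [FiniteDimensional k (P.obj 2)] {n : ℕ}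
    (t : (P.hadamard P.quadDual).susp.obj n) : Prop :=
  ∀ (A : Type u) [AddCommGroup A] [Module k A] (α : Operad.Hom P (endOperad k A))
    (fs : Fin n → Σ a, (coeffOperad A P).invariants a) (r : ℕ) (h : ∑ i, (fs i).1 = r),
    (coeffOperad A P).opDelta ((algMap α).map 2 P.chi)
      ((coeffOperad A P).cup ((algMap α).map n t)) fs r h = 0

end Cochains

/-!
For a `P`-algebra `A` let `Q = s(End_A ⊗ P^!)`, with an element `m` of arity two, the image of `χ`.
The cocycle condition for `t` only says that the operation `(f₁, …, fₙ) ↦ Aver (t(f₁, …, fₙ))`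
on invariants of `Q` commutes with `d = Aver [m, -]` in the graded sense.

*Cocycles form a suboperad.* This holds for every operad `Q` and every `m`. The arguments of a
composition may be averaged if the result is averaged (`Operad.averT_grafts_aver`), so partial
compositions of elements of `Q` become, up to Koszul signs, partial compositions of operations
(`Operad.grafts_circ`), and transpositions of inputs become transpositions of arguments
(`Operad.averT_grafts_swap`). Operations that commute with `d` are closed under both
(`Operad.isClosedOp_circ`, `Operad.isClosedOp_act`). To avoid transports between arities,
compositions are computed in the direct sum of all components of `Q`, and arguments are kept in lists.

*The canonical elements.* Before suspension the element `χ'` of `P' ⊗ P'^!` is associative: the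
canonical element of a vector space dies in the tensor product of a quotient with the quotient of the
dual by the annihilator of the kernel (`sum_tmul_dual_eq_zero`, `NSOperad.chi_assoc`). As `P(2)` is
the sum of `P'(2)` and its translate by the transposition, `χ` is the anti-commutator of `χ'` in the
suspension (`chi_eq_anticommutator`). Let `μ` be the image of `χ'` in `Q`. Averages of pre-Lie
compositions do not see the actions, so `d = 2 Aver [μ, -]` is twice the Hochschild differential of
the anti-associative `μ`, and that is a derivation of the cup product `μ(f, g)` even before averaging
(`Operad.inj_bracket_mul`, `Operad.isClosedOp_of_assoc`). Thus `χ'` is a cocycle, and so is `χ`, by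
the closure properties.

*The morphisms.* A morphism out of the suspension of a presented operad is determined by the
generators (`Operad.susp_presented_hom_ext`), which gives all uniqueness statements and `L = A ∘ c`.
The morphism `A` is induced by the associative element `χ'`, the morphism `c` by the commutator of
the associative product, and `L` is obtained as `A ∘ c`.
-/

namespace Operad

/-! ### Full compositions on the direct sum of all arities -/

section Total

variable {k : Type u} [Field k] (Q : Operad k 1)

/-- The direct sum of all components of `Q`. -/
abbrev Total : Type u := DirectSum ℕ Q.obj

/-- Homogeneous elements of `Q`, with their arities. -/
abbrev Elt : Type u := Σ a, Q.obj a

/-- The inclusion of the arity `a` component into the direct sum. -/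
def inj (a : ℕ) : Q.obj a →ₗ[k] Q.Total := DirectSum.lof k ℕ Q.obj a

/-- The partial composition at input `p` on the direct sum; it is `0` on components that do not
have this input. -/
noncomputable def graft (p : ℕ) : Q.Total →ₗ[k] Q.Total →ₗ[k] Q.Total :=
  DirectSum.toModule k ℕ _ fun m =>
    (DirectSum.toModule k ℕ (Q.obj m →ₗ[k] Q.Total) fun n =>
      if h : p < m then
        ((Q.circ (m := m) (n := n) (r := m + n - 1) (by omega) ⟨p, h⟩).compr₂ (Q.inj _)).flip
      else 0).flip

variable {Q}

theorem graft_inj {p m n r : ℕ} (h : r + 1 = m + n) (hp : p < m) (x : Q.obj m) (y : Q.obj n) :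
    Q.graft p (Q.inj m x) (Q.inj n y) = Q.inj r (Q.circ h ⟨p, hp⟩ x y) := by
  obtain rfl : r = m + n - 1 := by omega
  simp [graft, inj, hp]

theorem graft_inj_of_le {p m : ℕ} (hp : m ≤ p) (x : Q.obj m) : Q.graft p (Q.inj m x) = 0 := by
  refine DirectSum.linearMap_ext k fun n => ?_
  ext y
  simp [graft, inj, not_lt.2 hp]

theorem total_ext {M : Type*} [AddCommGroup M] [Module k M] {f g : Q.Total →ₗ[k] M}
    (h : ∀ a x, f (Q.inj a x) = g (Q.inj a x)) : f = g :=
  DirectSum.linearMap_ext k fun a => LinearMap.ext fun x => h a x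

variable (Q) in
/-- Composition of the elements of a list into consecutive inputs, the first `p` inputs being
done. -/
noncomputable def grafts : ℕ → List Q.Elt → Q.Total →ₗ[k] Q.Total
  | _, [] => LinearMap.id
  | p, f :: l => grafts (p + f.1) l ∘ₗ (Q.graft p).flip (Q.inj f.1 f.2)

@[simp] theorem grafts_nil (p : ℕ) (x : Q.Total) : Q.grafts p [] x = x := rfl

@[simp] theorem grafts_cons (p : ℕ) (f : Q.Elt) (l : List Q.Elt) (x : Q.Total) :
    Q.grafts p (f :: l) x = Q.grafts (p + f.1) l (Q.graft p x (Q.inj f.1 f.2)) := rfl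

/-- The sum of the arities of the elements of a list. -/
def arities (l : List Q.Elt) : ℕ := (l.map Sigma.fst).sum

@[simp] theorem arities_nil : arities ([] : List Q.Elt) = 0 := rfl

@[simp] theorem arities_cons (f : Q.Elt) (l : List Q.Elt) :
    arities (f :: l) = f.1 + arities l := by simp [arities]

theorem grafts_append (p : ℕ) (l l' : List Q.Elt) (x : Q.Total) :
    Q.grafts p (l ++ l') x = Q.grafts (p + arities l) l' (Q.grafts p l x) := by
  induction l generalizing p x with
  | nil => simp
  | cons f l ih => simp [ih, add_assoc]

/-- A full composition is homogeneous. -/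
theorem exists_grafts_inj (l : List Q.Elt) {p s : ℕ} (x : Q.obj s) (h : p + l.length ≤ s) :
    ∃ r, ∃ y : Q.obj r, r + l.length = s + arities l ∧ Q.grafts p l (Q.inj s x) = Q.inj r y := by
  induction l generalizing p s with
  | nil => exact ⟨s, x, by simp, rfl⟩
  | cons f l ih =>
    simp only [List.length_cons] at h
    obtain ⟨r, y, hr, hy⟩ := ih (p := p + f.1) (s := s + f.1 - 1)
      (Q.circ (by omega) ⟨p, by omega⟩ x f.2) (by omega)
    refine ⟨r, y, by simp; omega, ?_⟩
    rw [grafts_cons, graft_inj (r := s + f.1 - 1) (by omega) (by omega), hy]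

/-- The full composition, computed in the direct sum. -/
theorem inj_gammaAux (q p s r : ℕ) (hs : s = p + q) (x : Q.obj s) (fs : Fin q → Q.Elt)
    (h : p + ∑ i, (fs i).1 = r) :
    Q.inj r (Q.gammaAux q p s r hs x fs h) = Q.grafts p (List.ofFn fs) (Q.inj s x) := by
  induction q generalizing p s with
  | zero =>
    obtain rfl : s = r := by rw [Fin.sum_univ_zero] at h; omega
    simp [gammaAux]
  | succ q ih =>
    rw [gammaAux, ih, List.ofFn_succ, grafts_cons, graft_inj]

/-! ### Existence of block permutations and averaging -/

/-- Any permutations of outer and grafted inputs induce a permutation of a partial composition. -/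
theorem exists_isBlockPerm {m n r : ℕ} (h : r + 1 = m + n) (i : Fin m) (σ : Equiv.Perm (Fin m))
    (τ : Equiv.Perm (Fin n)) : ∃ ρ : Equiv.Perm (Fin r), IsBlockPerm i σ τ ρ := by
  have hi := i.2
  have hsi := (σ i).2
  -- each input of the composition is one of the grafted inputs or one of the remaining outer ones
  have cover : ∀ p : Fin r, (∃ y : Fin n, (p : ℕ) = i + y) ∨
      ∃ w : Fin m, w ≠ i ∧ (p : ℕ) = insSlot n i w := by
    intro p
    have hp := p.2
    by_cases h1 : (p : ℕ) < i
    · exact Or.inr ⟨⟨p, by omega⟩, by simp [Fin.ext_iff]; omega, by simp [insSlot]; omega⟩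
    by_cases h2 : (i : ℕ) + n ≤ p
    · refine Or.inr ⟨⟨p + 1 - n, by omega⟩, by simp [Fin.ext_iff]; omega, ?_⟩
      simp only [insSlot]; split_ifs <;> omega
    · exact Or.inl ⟨⟨p - i, by omega⟩, by simp; omega⟩
  have hne : ∀ w : Fin m, w ≠ i → (w : ℕ) ≠ i ∧ (σ w : ℕ) ≠ σ i := fun w hw =>
    ⟨fun e => hw (Fin.ext e), fun e => hw (σ.injective (Fin.ext e))⟩
  have ex : ∀ p : Fin r, ∃ q : Fin r, (∀ y : Fin n, (p : ℕ) = i + y → (q : ℕ) = σ i + τ y) ∧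
      ∀ w : Fin m, w ≠ i → (p : ℕ) = insSlot n i w → (q : ℕ) = insSlot n (σ i) (σ w) := by
    intro p
    rcases cover p with ⟨y, hy⟩ | ⟨w, hw, hp⟩
    · refine ⟨⟨σ i + τ y, by omega⟩, fun y' hy' => ?_, fun w hw hp => ?_⟩
      · obtain rfl : y = y' := Fin.ext (by omega)
        rfl
      · have := hne w hw
        simp only [insSlot] at hp; split_ifs at hp <;> omega
    · have := hne w hw
      have hsw := (σ w).2
      refine ⟨⟨insSlot n (σ i) (σ w), by simp only [insSlot]; split_ifs <;> omega⟩,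
        fun y hy => ?_, fun w' hw' hp' => ?_⟩
      · simp only [insSlot] at hp; split_ifs at hp <;> omega
      · have := hne w' hw'
        obtain rfl : w = w' := Fin.ext (by
          simp only [insSlot] at hp hp'; split_ifs at hp hp' <;> omega)
        rfl
  choose f hf using ex
  have hinj : Function.Injective f := by
    intro p q hpq
    have hpq' : (f p : ℕ) = f q := congrArg _ hpq
    rcases cover p with ⟨y, hy⟩ | ⟨w, hw, hp⟩ <;> rcases cover q with ⟨y', hy'⟩ | ⟨w', hw', hq⟩
    · rw [(hf p).1 y hy, (hf q).1 y' hy'] at hpq'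
      obtain rfl : y = y' := τ.injective (Fin.ext (by omega))
      exact Fin.ext (by omega)
    · rw [(hf p).1 y hy, (hf q).2 w' hw' hq] at hpq'
      have := hne w' hw'
      simp only [insSlot] at hpq'; split_ifs at hpq' <;> omega
    · rw [(hf p).2 w hw hp, (hf q).1 y' hy'] at hpq'
      have := hne w hw
      simp only [insSlot] at hpq'; split_ifs at hpq' <;> omega
    · rw [(hf p).2 w hw hp, (hf q).2 w' hw' hq] at hpq'
      have := hne w hw
      have := hne w' hw'
      obtain rfl : w = w' := σ.injective (Fin.ext (by
        simp only [insSlot] at hpq'; split_ifs at hpq' <;> omega))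
      exact Fin.ext (by omega)
  refine ⟨Equiv.ofBijective f (Finite.injective_iff_bijective.1 hinj), ?_, ?_⟩
  · exact fun y p hp => (hf p).1 y hp
  · exact fun w p hw hp => (hf p).2 w hw hp

theorem coe_aver {n : ℕ} (x : Q.obj n) : (Q.aver n x : Q.obj n) =
    (Fintype.card (Equiv.Perm (Fin n)) : k)⁻¹ • ∑ σ, Q.act σ x := by
  change (((Fintype.card (Equiv.Perm (Fin n)) : k)⁻¹ • ∑ σ, Q.act σ : Q.obj n →ₗ[k] Q.obj n)) x = _
  rw [LinearMap.smul_apply, LinearMap.sum_apply]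

theorem aver_act {n : ℕ} (σ : Equiv.Perm (Fin n)) (x : Q.obj n) :
    Q.aver n (Q.act σ x) = Q.aver n x := by
  refine Subtype.ext ?_
  simp only [coe_aver, ← Q.act_mul]
  congr 1
  exact Fintype.sum_equiv (Equiv.mulLeft σ) _ _ fun _ => rfl

/-- A linear map that does not see the actions does not see averaging. -/
theorem map_aver [CharZero k] {M : Type*} [AddCommGroup M] [Module k M] {n : ℕ}
    (F : Q.obj n →ₗ[k] M) (hF : ∀ σ x, F (Q.act σ x) = F x) (x : Q.obj n) :
    F (Q.aver n x : Q.obj n) = F x := by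
  have hc : (Fintype.card (Equiv.Perm (Fin n)) : k) ≠ 0 := by
    exact_mod_cast Fintype.card_ne_zero
  simp only [coe_aver, map_smul, map_sum, hF, Finset.sum_const, Finset.card_univ, ← Nat.cast_smul_eq_nsmul k,
    smul_smul, inv_mul_cancel₀ hc, one_smul]

theorem aver_aver [CharZero k] {n : ℕ} (x : Q.obj n) :
    Q.aver n (Q.aver n x : Q.obj n) = Q.aver n x :=
  map_aver _ aver_act x

variable (Q) in
/-- The averaging projection on the direct sum. -/
noncomputable def averT : Q.Total →ₗ[k] Q.Total :=
  DirectSum.toModule k ℕ _ fun a => Q.inj a ∘ₗ (Q.invariants a).subtype ∘ₗ Q.aver a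

theorem averT_inj {a : ℕ} (x : Q.obj a) : Q.averT (Q.inj a x) = Q.inj a (Q.aver a x) := by
  simp [averT, inj]

/-- Permuting inputs that are already done does not change a composition after averaging. -/
theorem averT_grafts_act (l : List Q.Elt) {p s : ℕ} (σ : Equiv.Perm (Fin s))
    (hσ : ∀ z : Fin s, p ≤ z → σ z = z) (x : Q.obj s) :
    Q.averT (Q.grafts p l (Q.inj s (Q.act σ x))) = Q.averT (Q.grafts p l (Q.inj s x)) := by
  induction l generalizing p s with
  | nil => simp only [grafts_nil, averT_inj, aver_act]
  | cons f l ih =>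
    rw [grafts_cons, grafts_cons]
    by_cases hp : p < s
    swap
    · rw [graft_inj_of_le (by omega), graft_inj_of_le (by omega)]
    obtain ⟨ρ, hρ⟩ := exists_isBlockPerm (n := f.1) (r := s + f.1 - 1) (by omega) ⟨p, hp⟩ σ 1
    have hσp : σ ⟨p, hp⟩ = ⟨p, hp⟩ := hσ _ le_rfl
    have e := Q.circ_act (by omega) ⟨p, hp⟩ σ 1 ρ hρ x f.2
    rw [Q.act_one, hσp] at e
    rw [graft_inj (r := s + f.1 - 1) (by omega) hp, graft_inj (r := s + f.1 - 1) (by omega) hp, e]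
    refine ih ρ (fun z hz => Fin.ext ?_) _
    have h2 := hρ.2 ⟨z + 1 - f.1, by omega⟩ z (by simp [Fin.ext_iff]; omega)
      (by simp only [insSlot]; split_ifs <;> omega)
    rw [hσp, hσ _ (by simp; omega)] at h2
    rw [h2]
    simp only [insSlot]; split_ifs <;> omega

theorem averT_grafts_cons_act (l : List Q.Elt) (p : ℕ) {a : ℕ} (τ : Equiv.Perm (Fin a))
    (z : Q.obj a) (x : Q.Total) :
    Q.averT (Q.grafts p (⟨a, Q.act τ z⟩ :: l) x) = Q.averT (Q.grafts p (⟨a, z⟩ :: l) x) := by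
  have : Q.averT ∘ₗ Q.grafts p (⟨a, Q.act τ z⟩ :: l) = Q.averT ∘ₗ Q.grafts p (⟨a, z⟩ :: l) := by
    refine total_ext fun s x => ?_
    simp only [LinearMap.comp_apply, grafts_cons]
    by_cases hp : p < s
    swap
    · rw [graft_inj_of_le (by omega)]; rfl
    obtain ⟨ρ, hρ⟩ := exists_isBlockPerm (n := a) (r := s + a - 1) (by omega) ⟨p, hp⟩ 1 τ
    have e := Q.circ_act (by omega) ⟨p, hp⟩ 1 τ ρ hρ x z
    rw [Q.act_one, Equiv.Perm.one_apply] at e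
    rw [graft_inj (r := s + a - 1) (by omega) hp, graft_inj (r := s + a - 1) (by omega) hp, e]
    refine averT_grafts_act l ρ (fun z hz => Fin.ext ?_) _
    have h2 := hρ.2 ⟨z + 1 - a, by omega⟩ z (by simp [Fin.ext_iff]; omega)
      (by simp only [insSlot]; split_ifs <;> omega)
    rw [Equiv.Perm.one_apply, Equiv.Perm.one_apply] at h2
    rw [h2]
    simp only [insSlot]; split_ifs <;> omega
  exact LinearMap.congr_fun this x

/-- The arguments of a composition may be averaged if the result is averaged. -/
theorem averT_grafts_aver [CharZero k] (l l' : List Q.Elt) (p : ℕ) {a : ℕ} (z : Q.obj a)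
    (x : Q.Total) :
    Q.averT (Q.grafts p (l ++ ⟨a, Q.aver a z⟩ :: l') x) =
      Q.averT (Q.grafts p (l ++ ⟨a, z⟩ :: l') x) := by
  rw [grafts_append, grafts_append]
  exact map_aver (Q.averT ∘ₗ Q.grafts _ l' ∘ₗ Q.graft _ _ ∘ₗ Q.inj a)
    (fun τ z => averT_grafts_cons_act l' _ τ z _) z

/-! ### The differential -/

/-- The bracket `m ∘ f - (-1)^|f| f ∘ m` with an element of degree one. -/
noncomputable def bracket (m : Q.obj 2) (a : ℕ) : Q.obj a →ₗ[k] Q.obj (a + 1) :=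
  (∑ i, Q.circ (m := 2) (n := a) (by omega) i m) -
    (-1 : k) ^ (a + 1) • ∑ i, (Q.circ (m := a) (n := 2) rfl i).flip m

theorem bracket_apply (m : Q.obj 2) {a : ℕ} (f : Q.obj a) :
    bracket m a f = Q.preLie (m := 2) (n := a) (by omega) m f -
      (-1 : k) ^ (a + 1) • Q.preLie (m := a) (n := 2) rfl f m := by
  simp [bracket, preLie]

/-- The differential, on not necessarily invariant elements. -/
noncomputable def dL (m : Q.obj 2) (a : ℕ) : Q.obj a →ₗ[k] Q.obj (a + 1) :=
  (Q.invariants (a + 1)).subtype ∘ₗ Q.aver (a + 1) ∘ₗ bracket m a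

theorem dL_apply (m : Q.obj 2) {a : ℕ} (f : Q.obj a) :
    dL m a f = (Q.aver (a + 1) (bracket m a f) : Q.obj (a + 1)) := rfl

theorem coe_cochainD (m : Q.obj 2) {a : ℕ} (f : Q.invariants a) :
    (Q.cochainD m f : Q.obj (a + 1)) = dL m a f := by
  rw [dL_apply, bracket_apply]; rfl

/-- The differential of a homogeneous element. -/
noncomputable def dE (m : Q.obj 2) (f : Q.Elt) : Q.Elt := ⟨f.1 + 1, dL m f.1 f.2⟩

/-- The differential on the direct sum. -/
noncomputable def dT (m : Q.obj 2) : Q.Total →ₗ[k] Q.Total :=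
  DirectSum.toModule k ℕ _ fun a => Q.inj (a + 1) ∘ₗ dL m a

theorem dT_inj (m : Q.obj 2) {a : ℕ} (f : Q.obj a) :
    dT m (Q.inj a f) = Q.inj (a + 1) (dL m a f) := by
  simp [dT, inj]

/-- A pre-Lie composition is equivariant up to a permutation of the inputs of the result. -/
theorem aver_preLie_act {m n r : ℕ} (h : r + 1 = m + n) (σ : Equiv.Perm (Fin m))
    (τ : Equiv.Perm (Fin n)) (x : Q.obj m) (y : Q.obj n) :
    Q.aver r (Q.preLie h (Q.act σ x) (Q.act τ y)) = Q.aver r (Q.preLie h x y) := by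
  simp only [preLie, map_sum]
  refine Fintype.sum_equiv σ _ _ fun i => ?_
  obtain ⟨ρ, hρ⟩ := exists_isBlockPerm h i σ τ
  rw [Q.circ_act h i σ τ ρ hρ, aver_act]

theorem dL_act (m : Q.obj 2) {a : ℕ} (σ : Equiv.Perm (Fin a)) (x : Q.obj a) :
    dL m a (Q.act σ x) = dL m a x := by
  have e1 := aver_preLie_act (Q := Q) (m := 2) (n := a) (r := a + 1) (by omega) 1 σ m x
  have e2 := aver_preLie_act (Q := Q) (m := a) (n := 2) (r := a + 1) (by omega) σ 1 x m
  rw [Q.act_one] at e1 e2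
  rw [dL_apply, dL_apply, bracket_apply, bracket_apply, map_sub, map_sub, map_smul, map_smul, e1,
    e2]

theorem dT_averT [CharZero k] (m : Q.obj 2) (x : Q.Total) : dT m (Q.averT x) = dT m x := by
  have : dT m ∘ₗ Q.averT = dT m := total_ext fun a x => by
    rw [LinearMap.comp_apply, averT_inj, dT_inj, dT_inj]
    exact congrArg _ (map_aver (dL m a) (fun σ x => dL_act m σ x) x)
  exact LinearMap.congr_fun this x

/-! ### Leibniz sums -/

/-- The sum of `± K(f₁, …, d fᵢ, …, fₙ)` with the Koszul signs of a map `d` of degree one. -/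
noncomputable def leibniz (m : Q.obj 2) : (List Q.Elt → Q.Total) → List Q.Elt → Q.Total
  | _, [] => 0
  | K, f :: l => K (dE m f :: l) + (-1 : k) ^ (f.1 + 1) • leibniz m (fun l' => K (f :: l')) l

/-- A number with the parity of the sum of the degrees `|f|`: the degree `a - 1` is replaced by `a + 1`. -/
def degs (l : List Q.Elt) : ℕ := (l.map fun f => f.1 + 1).sum

@[simp] theorem degs_nil : degs ([] : List Q.Elt) = 0 := rfl

@[simp] theorem degs_cons (f : Q.Elt) (l : List Q.Elt) :
    degs (f :: l) = f.1 + 1 + degs l := by simp [degs]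

theorem degs_eq (l : List Q.Elt) : degs l = arities l + l.length := by
  induction l with
  | nil => rfl
  | cons f l ih => simp [ih]; omega

/-- The signs of a Leibniz sum over a concatenation. -/
theorem leibniz_append (m : Q.obj 2) (K : List Q.Elt → Q.Total) (l l' : List Q.Elt) :
    leibniz m K (l ++ l') = leibniz m (fun l₁ => K (l₁ ++ l')) l +
      (-1 : k) ^ degs l • leibniz m (fun l₁ => K (l ++ l₁)) l' := by
  induction l generalizing K with
  | nil => simp [leibniz]
  | cons f l ih =>
    simp only [List.cons_append, leibniz, ih, smul_add, smul_smul, degs_cons, pow_add, add_assoc,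
      mul_assoc]

/-- The lists in a Leibniz sum have one more input in total than the given one. -/
theorem leibniz_congr (m : Q.obj 2) {K K' : List Q.Elt → Q.Total} {l : List Q.Elt}
    (h : ∀ l', l'.length = l.length → arities l' = arities l + 1 → K l' = K' l') :
    leibniz m K l = leibniz m K' l := by
  induction l generalizing K K' with
  | nil => rfl
  | cons f l ih =>
    rw [leibniz, leibniz, h _ (by simp) (by simp [dE]; omega),
      ih fun l' hl ha => h _ (by simp [hl]) (by simp [ha]; omega)]

theorem leibniz_map (m : Q.obj 2) (F : Q.Total →ₗ[k] Q.Total) (K : List Q.Elt → Q.Total)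
    (l : List Q.Elt) : leibniz m (fun l' => F (K l')) l = F (leibniz m K l) := by
  induction l generalizing K with
  | nil => simp [leibniz]
  | cons f l ih => simp only [leibniz, ih, map_add, map_smul]

theorem leibniz_smul (m : Q.obj 2) (s : k) (K : List Q.Elt → Q.Total)
    (l : List Q.Elt) : leibniz m (fun l' => s • K l') l = s • leibniz m K l :=
  leibniz_map m (s • LinearMap.id) K l

theorem leibniz_ofFn (m : Q.obj 2) (K : List Q.Elt → Q.Total) {n : ℕ} (fs : Fin n → Q.Elt) :
    leibniz m K (List.ofFn fs) = ∑ i, (-1 : k) ^ (∑ j with j < i, ((fs j).1 + 1)) •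
      K (List.ofFn (Function.update fs i (dE m (fs i)))) := by
  induction n generalizing K with
  | zero => simp [leibniz]
  | succ n ih =>
    rw [List.ofFn_succ, leibniz, ih, Fin.sum_univ_succ, Finset.smul_sum]
    congr 1
    · simp [List.ofFn_succ]
    · refine Finset.sum_congr rfl fun i _ => ?_
      rw [smul_smul, ← pow_add]
      congr 1
      · congr 1
        rw [Finset.sum_filter, Finset.sum_filter, Fin.sum_univ_succ]
        simp
      · rw [List.ofFn_succ, Function.update_of_ne (Fin.succ_ne_zero i).symm]
        congr 3
        funext j
        simp [Function.update_apply]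

/-! ### Closed operations -/

/-- The operation given by `t` on invariants is closed: the cocycle condition, with lists of
arguments. -/
def IsClosedOp (m : Q.obj 2) (n : ℕ) (t : Q.obj n) : Prop :=
  ∀ l : List Q.Elt, l.length = n → (∀ f ∈ l, f.2 ∈ Q.invariants f.1) →
    dT m (Q.averT (Q.grafts 0 l (Q.inj n t))) =
      (-1 : k) ^ (n + 1) • leibniz m (fun l' => Q.averT (Q.grafts 0 l' (Q.inj n t))) l

theorem inj_injective (a : ℕ) : Function.Injective (Q.inj a) := DirectSum.of_injective a

theorem inj_cup {n r : ℕ} (t : Q.obj n) (fs : Fin n → Σ a, Q.invariants a)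
    (h : ∑ i, (fs i).1 = r) : Q.inj r (Q.cup t fs r h : Q.obj r) =
      Q.averT (Q.grafts 0 (List.ofFn fun i => (⟨(fs i).1, (fs i).2.1⟩ : Q.Elt)) (Q.inj n t)) := by
  rw [cup, ← averT_inj, gamma, inj_gammaAux]

theorem inj_opDelta (m : Q.obj 2) {n r : ℕ} (t : Q.obj n) (fs : Fin n → Σ a, Q.invariants a)
    (h : ∑ i, (fs i).1 = r) : Q.inj (r + 1) (Q.opDelta m (Q.cup t) fs r h : Q.obj (r + 1)) =
      dT m (Q.averT (Q.grafts 0 (List.ofFn fun i => (⟨(fs i).1, (fs i).2.1⟩ : Q.Elt))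
        (Q.inj n t))) -
      (-1 : k) ^ (n + 1) • leibniz m (fun l' => Q.averT (Q.grafts 0 l' (Q.inj n t)))
        (List.ofFn fun i => (⟨(fs i).1, (fs i).2.1⟩ : Q.Elt)) := by
  rw [leibniz_ofFn, ← inj_cup t fs h, dT_inj, ← coe_cochainD, opDelta]
  simp only [AddSubgroupClass.coe_sub, Submodule.coe_smul, Submodule.coe_sum, map_sub, map_smul,
    map_sum, inj_cup]
  congr 2
  refine Finset.sum_congr rfl fun i _ => ?_
  congr 5
  funext j
  let e : (Σ a, Q.invariants a) → Q.Elt := fun f => ⟨f.1, f.2.1⟩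
  refine (Function.apply_update (fun _ => e) fs i _ j).trans ?_
  simp only [e, coe_cochainD]
  rfl

/-- The cocycle condition in terms of lists of arguments. -/
theorem isClosedOp_iff (m : Q.obj 2) {n : ℕ} (t : Q.obj n) : IsClosedOp m n t ↔
    ∀ (fs : Fin n → Σ a, Q.invariants a) (r : ℕ) (h : ∑ i, (fs i).1 = r),
      Q.opDelta m (Q.cup t) fs r h = 0 := by
  constructor
  · intro H fs r h
    refine Subtype.ext (inj_injective _ ?_)
    rw [inj_opDelta, H _ (by simp) (by simp [List.mem_ofFn]), sub_self]
    simp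
  · intro H l hl hinv
    subst hl
    have e := congrArg (fun z : Q.invariants _ => Q.inj _ z.1)
      (H (fun i => ⟨(l.get i).1, (l.get i).2, hinv _ (List.get_mem _ _)⟩) _ rfl)
    simp only [inj_opDelta, ZeroMemClass.coe_zero, map_zero, Sigma.eta, List.ofFn_get,
      sub_eq_zero] at e
    exact e

end Total

variable {k : Type u} [Field k] {Q : Operad k 1}

/-! ### Closed operations form a suboperad -/

theorem isClosedOp_one [CharZero k] (m : Q.obj 2) : IsClosedOp m 1 Q.one := by
  intro l hl hinv
  obtain ⟨f, rfl⟩ := List.length_eq_one_iff.1 hl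
  have key : ∀ g : Q.Elt, Q.grafts 0 [g] (Q.inj 1 Q.one) = Q.inj g.1 g.2 := fun g => by
    rw [grafts_cons, grafts_nil, graft_inj (r := g.1) (by omega) (by omega)]
    exact congrArg _ (Q.one_circ _ _)
  simp only [leibniz, key, smul_zero, add_zero]
  rw [dT_averT, dT_inj, dE, averT_inj]
  simp only [dL_apply, aver_aver]
  simp

theorem isClosedOp_zero (m : Q.obj 2) (n : ℕ) : IsClosedOp m n (0 : Q.obj n) := by
  intro l _ _
  have e := leibniz_map m (0 : Q.Total →ₗ[k] Q.Total) (fun _ => 0) l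
  simp only [LinearMap.zero_apply] at e
  simp only [map_zero, e, smul_zero]

theorem isClosedOp_add {m : Q.obj 2} {n : ℕ} {t t' : Q.obj n} (h : IsClosedOp m n t)
    (h' : IsClosedOp m n t') : IsClosedOp m n (t + t') := by
  intro l hl hinv
  have e : ∀ (K K' : List Q.Elt → Q.Total) (l : List Q.Elt),
      leibniz m (fun l' => K l' + K' l') l = leibniz m K l + leibniz m K' l := by
    intro K K' l
    induction l generalizing K K' with
    | nil => simp [leibniz]
    | cons f l ih => simp only [leibniz, ih, smul_add]; abel
  simp only [map_add, e, h l hl hinv, h' l hl hinv, smul_add]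

theorem isClosedOp_smul {m : Q.obj 2} {n : ℕ} {t : Q.obj n} (s : k) (h : IsClosedOp m n t) :
    IsClosedOp m n (s • t) := by
  intro l hl hinv
  simp only [map_smul, leibniz_smul, h l hl hinv, smul_comm s]

/-- Elements composed to the left of input `i` commute with the composition at `i`, up to a
Koszul sign. -/
theorem grafts_graft_of_le (l : List Q.Elt) {p i i' m n : ℕ} (t : Q.obj m) (s : Q.obj n)
    (hp : p + l.length ≤ i) (hi : i < m) (hi' : i + arities l = i' + l.length) :
    Q.grafts p l (Q.graft i (Q.inj m t) (Q.inj n s)) =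
      (-1 : k) ^ ((n + 1) * degs l) •
        Q.graft i' (Q.grafts p l (Q.inj m t)) (Q.inj n s) := by
  induction l generalizing p i m with
  | nil =>
    obtain rfl : i = i' := by simpa using hi'
    simp
  | cons f l ih =>
    simp only [List.length_cons, arities_cons] at hp hi'
    have e := Q.circ_circ_par (m := m) (n := f.1) (l := n) (s := m + f.1 - 1) (t := m + n - 1)
      (r := m + n - 1 + f.1 - 1) (by omega) (by omega) (by omega) (by omega) ⟨p, by omega⟩
      ⟨i, hi⟩ ⟨i + f.1 - 1, by omega⟩ ⟨p, by omega⟩ (by simp [Fin.lt_def]; omega)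
      (by simp; omega) rfl t f.2 s
    rw [grafts_cons, grafts_cons, graft_inj (r := m + n - 1) (by omega) hi,
      graft_inj (r := m + n - 1 + f.1 - 1) (by omega) (by omega),
      graft_inj (r := m + f.1 - 1) (by omega) (by omega)]
    have e' : Q.inj (m + n - 1 + f.1 - 1) (Q.circ (by omega) ⟨p, by omega⟩
        (Q.circ (r := m + n - 1) (by omega) ⟨i, hi⟩ t s) f.2) =
        (-1 : k) ^ ((n + 1) * (f.1 + 1)) • Q.graft (i + f.1 - 1)
          (Q.inj (m + f.1 - 1) (Q.circ (by omega) ⟨p, by omega⟩ t f.2)) (Q.inj n s) := by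
      rw [graft_inj (r := m + n - 1 + f.1 - 1) (by omega) (by omega), e, map_smul, smul_smul,
        ← pow_add, Even.neg_one_pow ⟨(n + 1) * (f.1 + 1), by ring⟩, one_smul]
    rw [e', map_smul, ih (p := p + f.1) (i := i + f.1 - 1) (m := m + f.1 - 1) _ (by omega)
      (by omega) (by omega), smul_smul, ← pow_add, degs_cons, mul_add (n + 1) (f.1 + 1)]

/-- Composition into the inputs of an element that is itself composed at input `q`. -/
theorem grafts_graft_seq (l : List Q.Elt) {p q n : ℕ} (x : Q.Total) (s : Q.obj n)
    (hp : p + l.length ≤ n) :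
    Q.grafts (q + p) l (Q.graft q x (Q.inj n s)) =
      Q.graft q x (Q.grafts p l (Q.inj n s)) := by
  induction l generalizing p n with
  | nil => simp
  | cons f l ih =>
    simp only [List.length_cons] at hp
    have e : Q.graft (q + p) (Q.graft q x (Q.inj n s)) (Q.inj f.1 f.2) =
        Q.graft q x (Q.graft p (Q.inj n s) (Q.inj f.1 f.2)) := by
      have : (Q.graft (q + p)).flip (Q.inj f.1 f.2) ∘ₗ (Q.graft q).flip (Q.inj n s) =
          (Q.graft q).flip (Q.graft p (Q.inj n s) (Q.inj f.1 f.2)) := by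
        refine total_ext fun m x => ?_
        simp only [LinearMap.comp_apply, LinearMap.flip_apply]
        by_cases hq : q < m
        swap
        · rw [graft_inj_of_le (by omega)]; simp
        rw [graft_inj (r := m + n - 1) (by omega) hq,
          graft_inj (r := m + n - 1 + f.1 - 1) (by omega) (by omega),
          graft_inj (r := n + f.1 - 1) (by omega) (by omega),
          graft_inj (r := m + n - 1 + f.1 - 1) (by omega) hq]
        exact congrArg _ (Q.circ_circ_seq (by omega) (by omega) (by omega) (by omega) ⟨q, hq⟩
          ⟨p, by omega⟩ _ rfl x s f.2)
      exact LinearMap.congr_fun this x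
    rw [grafts_cons, grafts_cons, e, graft_inj (r := n + f.1 - 1) (by omega) (by omega), add_assoc,
      ih _ (by omega)]

/-- Associativity of the full composition. -/
theorem grafts_circ {m n r : ℕ} (h : r + 1 = m + n) (i : Fin m) (t : Q.obj m) (s : Q.obj n)
    (l₁ l₂ l₃ : List Q.Elt) (h₁ : l₁.length = i) (h₂ : l₂.length = n) :
    Q.grafts 0 (l₁ ++ (l₂ ++ l₃)) (Q.inj r (Q.circ h i t s)) =
      (-1 : k) ^ ((n + 1) * degs l₁) • Q.grafts (arities l₁ + arities l₂) l₃
        (Q.graft (arities l₁) (Q.grafts 0 l₁ (Q.inj m t)) (Q.grafts 0 l₂ (Q.inj n s))) := by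
  rw [grafts_append, grafts_append, ← graft_inj h i.2,
    grafts_graft_of_le (i' := arities l₁) l₁ t s (by omega) i.2 (by omega), map_smul, map_smul,
    zero_add]
  have := grafts_graft_seq (p := 0) (q := arities l₁) l₂ (Q.grafts 0 l₁ (Q.inj m t)) s (by omega)
  rw [add_zero] at this
  rw [this]

theorem isClosedOp_circ [CharZero k] {m₂ : Q.obj 2} {m n r : ℕ} (h : r + 1 = m + n) (i : Fin m)
    {t : Q.obj m} {s : Q.obj n} (ht : IsClosedOp m₂ m t) (hs : IsClosedOp m₂ n s) :
    IsClosedOp m₂ r (Q.circ h i t s) := by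
  intro l hl hinv
  obtain ⟨l₁, l₂, l₃, rfl, h₁, h₂⟩ : ∃ l₁ l₂ l₃ : List Q.Elt, l = l₁ ++ (l₂ ++ l₃) ∧
      l₁.length = i ∧ l₂.length = n :=
    ⟨l.take i, (l.drop i).take n, (l.drop i).drop n, by simp, by simp; omega, by simp; omega⟩
  have h₃ : l₃.length + i + 1 = m := by simp at hl; omega
  obtain ⟨b, y, hb, hy⟩ := exists_grafts_inj l₂ (p := 0) s (by omega)
  have hb' : b = arities l₂ := by omega
  -- the composition of `t` with an element `z` at input `i`
  set H : List Q.Elt → Q.Elt → List Q.Elt → Q.Total := fun l₁ z l₃ =>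
    Q.averT (Q.grafts 0 (l₁ ++ z :: l₃) (Q.inj m t)) with hH
  set ybar : Q.Elt := ⟨b, Q.aver b y⟩ with hybar
  have key : ∀ l₁ l₃ : List Q.Elt, l₁.length = i →
      Q.averT (Q.grafts 0 (l₁ ++ (l₂ ++ l₃)) (Q.inj r (Q.circ h i t s))) =
        (-1 : k) ^ ((n + 1) * degs l₁) • H l₁ ybar l₃ := by
    intro l₁ l₃ h₁
    rw [grafts_circ h i t s l₁ l₂ l₃ h₁ h₂, map_smul, hH, hybar]
    dsimp only
    rw [averT_grafts_aver, grafts_append, grafts_cons, hy, zero_add, ← hb']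
  have hT := ht (l₁ ++ ybar :: l₃) (by simp; omega) (by
    intro f hf
    simp only [List.mem_append, List.mem_cons] at hf hinv
    rcases hf with hf | rfl | hf
    · exact hinv f (Or.inl hf)
    · exact (Q.aver b y).2
    · exact hinv f (Or.inr (Or.inr hf)))
  have hS := hs l₂ h₂ (fun f hf => hinv f (by simp [hf]))
  rw [hy, averT_inj, dT_inj] at hS
  -- the terms in which the differential hits an argument of `s`
  have mid : leibniz m₂ (fun l' => Q.averT (Q.grafts 0 (l₁ ++ (l' ++ l₃))
      (Q.inj r (Q.circ h i t s)))) l₂ =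
      (-1 : k) ^ ((n + 1) * degs l₁ + (n + 1)) • H l₁ (dE m₂ ybar) l₃ := by
    let Ω : Q.Total →ₗ[k] Q.Total := (-1 : k) ^ ((n + 1) * degs l₁) •
      (Q.averT ∘ₗ Q.grafts (arities l₁ + (b + 1)) l₃ ∘ₗ
        Q.graft (arities l₁) (Q.grafts 0 l₁ (Q.inj m t)))
    have hΩ : ∀ (a : ℕ) (z : Q.obj a), a = b + 1 →
        Ω (Q.inj a z) = (-1 : k) ^ ((n + 1) * degs l₁) • H l₁ ⟨a, z⟩ l₃ := by
      rintro a z rfl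
      simp [Ω, hH, grafts_append]
    have e : leibniz m₂ (fun l' => Q.averT (Q.grafts 0 (l₁ ++ (l' ++ l₃))
        (Q.inj r (Q.circ h i t s)))) l₂ =
        leibniz m₂ (fun l' => Ω (Q.averT (Q.grafts 0 l' (Q.inj n s)))) l₂ := by
      refine leibniz_congr m₂ fun l' hl' ha' => ?_
      obtain ⟨b', y', hb₁, hy'⟩ := exists_grafts_inj l' (p := 0) s (by omega)
      obtain rfl : b' = arities l' := by omega
      rw [grafts_circ h i t s l₁ l' l₃ h₁ (by omega), map_smul, hy', averT_inj, hΩ _ _ (by omega), hH]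
      dsimp only
      rw [averT_grafts_aver, grafts_append, grafts_cons, zero_add]
    have hS' : leibniz m₂ (fun l' => Q.averT (Q.grafts 0 l' (Q.inj n s))) l₂ =
        (-1 : k) ^ (n + 1) • Q.inj (b + 1) (dL m₂ b (Q.aver b y)) := by
      rw [hS, smul_smul, ← pow_add, Even.neg_one_pow ⟨n + 1, rfl⟩, one_smul]
    rw [e, leibniz_map, hS', map_smul, hΩ _ _ rfl, smul_smul, ← pow_add, add_comm (n + 1)]
    rfl
  -- the terms in which the differential hits an argument of `t` before `s`
  have fst : leibniz m₂ (fun l' => Q.averT (Q.grafts 0 (l' ++ (l₂ ++ l₃))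
      (Q.inj r (Q.circ h i t s)))) l₁ =
      (-1 : k) ^ ((n + 1) * (degs l₁ + 1)) • leibniz m₂ (fun l' => H l' ybar l₃) l₁ := by
    rw [← leibniz_smul]
    refine leibniz_congr m₂ fun l' hl' ha' => ?_
    rw [key l' l₃ (hl'.trans h₁), show degs l' = degs l₁ + 1 by rw [degs_eq, degs_eq]; omega]
  have lst : leibniz m₂ (fun l' => Q.averT (Q.grafts 0 (l₁ ++ (l₂ ++ l'))
      (Q.inj r (Q.circ h i t s)))) l₃ =
      (-1 : k) ^ ((n + 1) * degs l₁) • leibniz m₂ (fun l' => H l₁ ybar l') l₃ := by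
    rw [← leibniz_smul]
    exact leibniz_congr m₂ fun l' _ _ => key l₁ l' h₁
  rw [leibniz_append, leibniz] at hT
  rw [leibniz_append, leibniz_append, fst, mid, lst, key l₁ l₃ h₁, map_smul, hT]
  simp only [smul_add, smul_smul, ← pow_add, add_assoc]
  have hd : degs l₂ = b + n := by rw [degs_eq, h₂, hb']
  rw [hd]
  congr 1
  · congr 1
    apply neg_one_pow_eq_of_mod
    rw [mul_add]; omega
  congr 1
  · congr 1
    apply neg_one_pow_eq_of_mod
    omega
  · congr 1
    apply neg_one_pow_eq_of_mod
    simp only [hybar]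
    omega

/-! ### Equivariance -/

/-- Exchanging two adjacent arguments, after averaging. -/
theorem averT_grafts_swap (l₁ l₂ : List Q.Elt) (f g : Q.Elt) {p i n : ℕ} (hi : i + 1 < n)
    (hp : p + l₁.length = i) (t : Q.obj n) :
    Q.averT (Q.grafts p (l₁ ++ f :: g :: l₂)
        (Q.inj n (Q.act (Equiv.swap ⟨i, by omega⟩ ⟨i + 1, hi⟩) t))) =
      (-1 : k) ^ ((f.1 + 1) * (g.1 + 1)) •
        Q.averT (Q.grafts p (l₁ ++ g :: f :: l₂) (Q.inj n t)) := by
  induction l₁ generalizing p i n with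
  | nil =>
    obtain rfl : p = i := by simpa using hp
    obtain ⟨a, f⟩ := f
    obtain ⟨b, g⟩ := g
    set σ : Equiv.Perm (Fin n) := Equiv.swap ⟨p, by omega⟩ ⟨p + 1, hi⟩ with hσ
    have hσ₀ : σ ⟨p, by omega⟩ = ⟨p + 1, hi⟩ := Equiv.swap_apply_left _ _
    have hσ₁ : σ ⟨p + 1, hi⟩ = ⟨p, by omega⟩ := Equiv.swap_apply_right _ _
    have hσ₂ : ∀ z : Fin n, p + 1 < z → σ z = z := fun z hz =>
      Equiv.swap_apply_of_ne_of_ne (by simp [Fin.ext_iff]; omega) (by simp [Fin.ext_iff]; omega)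
    obtain ⟨ρ, hρ⟩ := exists_isBlockPerm (n := a) (r := n + a - 1) (by omega) ⟨p, by omega⟩ σ 1
    have hρ₁ : ρ ⟨p + a, by omega⟩ = ⟨p, by omega⟩ := Fin.ext (by
      have := hρ.2 ⟨p + 1, hi⟩ ⟨p + a, by omega⟩ (by simp) (by simp [insSlot])
      rw [hσ₀, hσ₁] at this
      simpa [insSlot] using this)
    have hρ₂ : ∀ z : Fin (n + a - 1), p + a < z → ρ z = z := fun z hz => Fin.ext (by
      have := hρ.2 ⟨z + 1 - a, by omega⟩ z (by simp [Fin.ext_iff]; omega)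
        (by simp only [insSlot]; split_ifs <;> omega)
      rw [hσ₀, hσ₂ _ (by simp; omega)] at this
      rw [this]; simp only [insSlot]; split_ifs <;> omega)
    obtain ⟨ρ', hρ'⟩ := exists_isBlockPerm (n := b) (r := n + a - 1 + b - 1) (by omega)
      ⟨p + a, by omega⟩ ρ 1
    have hρ'₂ : ∀ z : Fin (n + a - 1 + b - 1), p + a + b ≤ z → ρ' z = z := fun z hz => Fin.ext (by
      have := hρ'.2 ⟨z + 1 - b, by omega⟩ z (by simp [Fin.ext_iff]; omega)
        (by simp only [insSlot]; split_ifs <;> omega)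
      rw [hρ₁, hρ₂ _ (by simp; omega)] at this
      rw [this]; simp only [insSlot]; split_ifs <;> omega)
    have e₁ := Q.circ_act (by omega) ⟨p, by omega⟩ σ 1 ρ hρ t f
    rw [Q.act_one, hσ₀] at e₁
    have e₂ := Q.circ_act (by omega) ⟨p + a, by omega⟩ ρ 1 ρ' hρ'
      (Q.circ (by omega) ⟨p + 1, hi⟩ t f) g
    rw [Q.act_one, hρ₁] at e₂
    have e₃ := Q.circ_circ_par (m := n) (n := b) (l := a) (s := n + b - 1) (t := n + a - 1)
      (r := n + a - 1 + b - 1) (by omega) (by omega) (by omega) (by omega) ⟨p, by omega⟩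
      ⟨p + 1, hi⟩ ⟨p + b, by omega⟩ ⟨p, by omega⟩ (by simp [Fin.lt_def])
      (by simp; omega) rfl t g f
    simp only [List.nil_append, grafts_cons]
    rw [graft_inj (r := n + a - 1) (by omega) (by omega), e₁,
      graft_inj (r := n + a - 1 + b - 1) (by omega) (by omega), e₂, averT_grafts_act _ _ hρ'₂,
      graft_inj (r := n + b - 1) (by omega) (by omega),
      graft_inj (r := n + a - 1 + b - 1) (by omega) (by omega), e₃, add_right_comm p b a]
    simp only [map_smul, smul_smul, ← pow_add]
    rw [Even.neg_one_pow ⟨(a + 1) * (b + 1), by ring⟩, one_smul]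
  | cons h l₁ ih =>
    simp only [List.length_cons] at hp
    have hb : IsBlockPerm (m := n) (n := h.1) (r := n + h.1 - 1) ⟨p, by omega⟩
        (Equiv.swap ⟨i, by omega⟩ ⟨i + 1, hi⟩) 1
        (Equiv.swap ⟨i + h.1 - 1, by omega⟩ ⟨i + h.1 - 1 + 1, by omega⟩) := by
      have e : (Equiv.swap ⟨i, by omega⟩ ⟨i + 1, hi⟩ : Equiv.Perm (Fin n)) ⟨p, by omega⟩ =
          ⟨p, by omega⟩ := Equiv.swap_apply_of_ne_of_ne (by simp [Fin.ext_iff]; omega)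
            (by simp [Fin.ext_iff]; omega)
      constructor
      · intro y q hq
        rw [e, Equiv.swap_apply_of_ne_of_ne (by simp [Fin.ext_iff] at *; omega)
          (by simp [Fin.ext_iff] at *; omega), hq, Equiv.Perm.one_apply]
      · intro w q hw hq
        have hw' : (w : ℕ) ≠ p := fun e => hw (Fin.ext e)
        rw [e, Equiv.swap_apply_def, Equiv.swap_apply_def]
        simp only [insSlot, Fin.ext_iff] at hq ⊢
        split_ifs at hq ⊢ <;> simp at * <;> omega
    have e := Q.circ_act (by omega) ⟨p, by omega⟩ _ 1 _ hb t h.2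
    have e' : (Equiv.swap ⟨i, by omega⟩ ⟨i + 1, hi⟩ : Equiv.Perm (Fin n)) ⟨p, by omega⟩ =
          ⟨p, by omega⟩ := Equiv.swap_apply_of_ne_of_ne (by simp [Fin.ext_iff]; omega)
            (by simp [Fin.ext_iff]; omega)
    rw [Q.act_one, e'] at e
    rw [List.cons_append, List.cons_append, grafts_cons, grafts_cons,
      graft_inj (r := n + h.1 - 1) (by omega) (by omega),
      graft_inj (r := n + h.1 - 1) (by omega) (by omega), e]
    exact ih (by omega) (by omega) _

theorem isClosedOp_act_swap {m : Q.obj 2} {n i : ℕ} (hi : i + 1 < n) {t : Q.obj n}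
    (ht : IsClosedOp m n t) :
    IsClosedOp m n (Q.act (Equiv.swap ⟨i, by omega⟩ ⟨i + 1, hi⟩) t) := by
  intro l hl hinv
  obtain ⟨l₁, f, g, l₂, rfl, h₁⟩ : ∃ (l₁ : List Q.Elt) (f g : Q.Elt) (l₂ : List Q.Elt),
      l = l₁ ++ f :: g :: l₂ ∧ l₁.length = i := by
    refine ⟨l.take i, l[i], l[i + 1], l.drop (i + 2), ?_, by simp; omega⟩
    rw [← List.drop_eq_getElem_cons, ← List.drop_eq_getElem_cons, List.take_append_drop]
  have key := fun (l₁ l₂ : List Q.Elt) (f g : Q.Elt) (h₁ : l₁.length = i) =>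
    averT_grafts_swap l₁ l₂ f g (p := 0) hi (by omega) t
  have e := ht (l₁ ++ g :: f :: l₂) (by simpa using hl) (by
    intro x hx; apply hinv; simp at hx ⊢; tauto)
  have fst : leibniz m (fun l' => Q.averT (Q.grafts 0 (l' ++ f :: g :: l₂)
      (Q.inj n (Q.act (Equiv.swap ⟨i, by omega⟩ ⟨i + 1, hi⟩) t)))) l₁ =
      (-1 : k) ^ ((f.1 + 1) * (g.1 + 1)) • leibniz m (fun l' =>
        Q.averT (Q.grafts 0 (l' ++ g :: f :: l₂) (Q.inj n t))) l₁ := by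
    rw [← leibniz_smul]
    exact leibniz_congr m fun l' hl' _ => key l' l₂ f g (hl'.trans h₁)
  rw [leibniz_append] at e ⊢
  simp only [leibniz] at e ⊢
  rw [key _ _ _ _ h₁, map_smul, e, fst]
  simp only [key _ _ _ _ h₁, leibniz_smul, smul_add, smul_smul, ← pow_add]
  rw [add_left_comm (_ • _) (_ • _) (_ • _)]
  have c : ∀ {a b : ℕ} (x : Q.Total), a % 2 = b % 2 → (-1 : k) ^ a • x = (-1 : k) ^ b • x :=
    fun x hab => by rw [neg_one_pow_eq_of_mod hab]
  have d₁ : ((dE m f).1 + 1) * (g.1 + 1) = (f.1 + 1) * (g.1 + 1) + (g.1 + 1) :=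
    add_one_mul (f.1 + 1) (g.1 + 1)
  have d₂ : (f.1 + 1) * ((dE m g).1 + 1) = (f.1 + 1) * (g.1 + 1) + (f.1 + 1) :=
    mul_add_one (f.1 + 1) (g.1 + 1)
  rw [d₁, d₂]
  exact congrArg₂ (· + ·) (c _ (by omega)) (congrArg₂ (· + ·) (c _ (by omega))
    (congrArg₂ (· + ·) (c _ (by omega)) (c _ (by omega))))

theorem isClosedOp_act {m : Q.obj 2} {n : ℕ} (σ : Equiv.Perm (Fin n)) {t : Q.obj n}
    (ht : IsClosedOp m n t) : IsClosedOp m n (Q.act σ t) := by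
  cases n with
  | zero => rw [Subsingleton.elim σ 1, Q.act_one]; exact ht
  | succ n =>
    have hσ : σ ∈ Submonoid.closure
        (Set.range fun i : Fin n => Equiv.swap i.castSucc i.succ) := by
      rw [Equiv.Perm.mclosure_swap_castSucc_succ]; trivial
    induction hσ using Submonoid.closure_induction generalizing t with
    | mem σ h =>
      obtain ⟨i, rfl⟩ := h
      exact isClosedOp_act_swap (i := i) (by omega) ht
    | one => rw [Q.act_one]; exact ht
    | mul σ τ _ _ h₁ h₂ => rw [Q.act_mul]; exact h₂ (h₁ ht)

/-! ### The cup product -/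

/-- Sequential associativity on the direct sum. -/
theorem graft_graft_seq {p q n : ℕ} (x y : Q.Total) (s : Q.obj n) (hp : p < n) :
    Q.graft q x (Q.graft p (Q.inj n s) y) = Q.graft (q + p) (Q.graft q x (Q.inj n s)) y := by
  have : Q.graft q x ∘ₗ Q.graft p (Q.inj n s) = Q.graft (q + p) (Q.graft q x (Q.inj n s)) :=
    total_ext fun a f => (grafts_graft_seq [⟨a, f⟩] x s (by simpa using hp)).symm
  exact LinearMap.congr_fun this y

/-- Parallel associativity on the direct sum. -/
theorem graft_graft_par {p i i' m n a : ℕ} (t : Q.obj m) (s : Q.obj n) (f : Q.obj a)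
    (hp : p < i) (hi : i < m) (hi' : i + a = i' + 1) :
    Q.graft p (Q.graft i (Q.inj m t) (Q.inj n s)) (Q.inj a f) =
      (-1 : k) ^ ((n + 1) * (a + 1)) •
        Q.graft i' (Q.graft p (Q.inj m t) (Q.inj a f)) (Q.inj n s) := by
  simpa using grafts_graft_of_le [⟨a, f⟩] (p := p) (i := i) (i' := i') t s
    (by simp; omega) hi (by simpa using hi')

theorem inj_bracket (μ : Q.obj 2) {a : ℕ} (x : Q.obj a) :
    Q.inj (a + 1) (bracket μ a x) =
      Q.graft 0 (Q.inj 2 μ) (Q.inj a x) + Q.graft 1 (Q.inj 2 μ) (Q.inj a x) -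
      (-1 : k) ^ (a + 1) • ∑ i : Fin a, Q.graft i (Q.inj a x) (Q.inj 2 μ) := by
  rw [bracket_apply, map_sub, map_smul, preLie, preLie, map_sum, map_sum, Fin.sum_univ_two,
    graft_inj (r := a + 1) (by omega) (by omega), graft_inj (r := a + 1) (by omega) (by omega)]
  congr 2
  refine Finset.sum_congr rfl fun i _ => ?_
  rw [graft_inj (n := 2) (r := a + 1) rfl i.2]

/-- The Hochschild differential `[μ, -]` of an associative `μ` of degree one is a derivation of
the cup product `μ(f, g)`. -/
theorem inj_bracket_mul (μ : Q.obj 2)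
    (hμ : Q.circ (m := 2) (n := 2) (r := 3) rfl 0 μ μ =
      -Q.circ (m := 2) (n := 2) (r := 3) rfl 1 μ μ) {a b : ℕ} (f : Q.obj a) (g : Q.obj b)
    (y : Q.obj (a + b)) (hy : Q.grafts 0 [⟨a, f⟩, ⟨b, g⟩] (Q.inj 2 μ) = Q.inj (a + b) y) :
    Q.inj (a + b + 1) (bracket μ (a + b) y) =
      -(Q.grafts 0 [⟨a + 1, bracket μ a f⟩, ⟨b, g⟩] (Q.inj 2 μ) +
        (-1 : k) ^ (a + 1) • Q.grafts 0 [⟨a, f⟩, ⟨b + 1, bracket μ b g⟩] (Q.inj 2 μ)) := by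
  rw [inj_bracket]
  simp only [grafts_cons, grafts_nil, zero_add, inj_bracket] at hy ⊢
  rw [← hy]
  obtain ⟨X, hX⟩ : ∃ X : Q.obj (a + 1), Q.graft 0 (Q.inj 2 μ) (Q.inj a f) = Q.inj (a + 1) X :=
    ⟨_, graft_inj (by omega) (by omega) _ _⟩
  have hass : Q.graft 1 (Q.inj 2 μ) (Q.inj 2 μ) = -Q.graft 0 (Q.inj 2 μ) (Q.inj 2 μ) := by
    rw [graft_inj (n := 2) (r := 3) rfl (by omega), graft_inj (n := 2) (r := 3) rfl (by omega),
      ← map_neg]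
    exact congrArg _ (neg_eq_iff_eq_neg.2 hμ).symm
  set M := Q.inj 2 μ with hM
  -- the two terms in which `μ(f, g)` is an argument of `μ`
  have t₁ : Q.graft 0 M (Q.graft a (Q.graft 0 M (Q.inj a f)) (Q.inj b g)) =
      Q.graft a (Q.graft 0 (Q.graft 0 M M) (Q.inj a f)) (Q.inj b g) := by
    rw [hX, graft_graft_seq _ _ _ (by omega), ← hX, hM, graft_graft_seq _ _ _ (by omega)]
    simp
  have t₂ : Q.graft 1 M (Q.graft a (Q.graft 0 M (Q.inj a f)) (Q.inj b g)) =
      -Q.graft (a + 1) (Q.graft 1 (Q.graft 0 M M) (Q.inj a f)) (Q.inj b g) := by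
    rw [hX, graft_graft_seq _ _ _ (by omega), ← hX, hM, graft_graft_seq _ _ _ (by omega),
      ← hM, hass, add_comm 1 a]
    simp
  -- `μ` is composed into an input of `f` or of `g`
  have t₃ : ∀ i : Fin a, Q.graft i (Q.graft a (Q.graft 0 M (Q.inj a f)) (Q.inj b g)) M =
      (-1 : k) ^ (b + 1) • Q.graft (a + 1) (Q.graft 0 M (Q.graft i (Q.inj a f) M)) (Q.inj b g) := by
    intro i
    rw [graft_graft_seq _ _ _ i.2, hX, hM, graft_graft_par (i' := a + 1) _ _ _ i.2 (by omega) rfl,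
      zero_add, neg_one_pow_eq_of_mod (b := b + 1) (by omega)]
  have t₄ : ∀ i : ℕ, i < b → Q.graft (a + i) (Q.graft a (Q.graft 0 M (Q.inj a f)) (Q.inj b g)) M =
      Q.graft a (Q.graft 0 M (Q.inj a f)) (Q.graft i (Q.inj b g) M) := by
    intro i hi
    rw [graft_graft_seq _ _ _ hi]
  have t₅ : Q.graft 0 M (Q.graft 0 M (Q.inj a f)) = Q.graft 0 (Q.graft 0 M M) (Q.inj a f) := by
    rw [hM, graft_graft_seq _ _ _ (by omega)]
  have t₆ : Q.graft 0 M (Q.graft 1 M (Q.inj a f)) = Q.graft 1 (Q.graft 0 M M) (Q.inj a f) := by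
    rw [hM, graft_graft_seq _ _ _ (by omega)]
  have t₇ : Q.graft a (Q.graft 0 M (Q.inj a f)) M =
      -(-1 : k) ^ (a + 1) • Q.graft 0 (Q.graft 0 M M) (Q.inj a f) := by
    have := graft_graft_par (p := 0) (i' := a) μ μ f one_pos (by omega) (by omega)
    rw [← hM, hass, neg_one_pow_eq_of_mod (b := a + 1) (by omega)] at this
    rw [neg_smul, ← smul_neg, ← LinearMap.neg_apply, ← map_neg, this, smul_smul, ← pow_add,
      Even.neg_one_pow ⟨a + 1, rfl⟩, one_smul]
  have t₈ : Q.graft a (Q.graft 0 M (Q.inj a f)) (Q.graft 0 M (Q.inj b g)) =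
      -(-1 : k) ^ (a + 1) • Q.graft a (Q.graft 0 (Q.graft 0 M M) (Q.inj a f)) (Q.inj b g) := by
    rw [hM, graft_graft_seq _ _ _ (by omega), ← hM, t₇]
    simp
  have t₉ : Q.graft a (Q.graft 0 M (Q.inj a f)) (Q.graft 1 M (Q.inj b g)) =
      -(-1 : k) ^ (a + 1) •
        Q.graft (a + 1) (Q.graft 0 (Q.graft 0 M M) (Q.inj a f)) (Q.inj b g) := by
    rw [hM, graft_graft_seq _ _ _ (by omega), ← hM, t₇]
    simp
  simp only [map_sub, map_add, map_smul, map_sum, LinearMap.sub_apply, LinearMap.add_apply,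
    LinearMap.smul_apply, LinearMap.sum_apply, t₁, t₂, t₅, t₆, t₈, t₉, Fin.sum_univ_add,
    Fin.val_castAdd, Fin.val_natAdd, t₃, t₄ _ (Fin.is_lt _), ← Finset.smul_sum]
  have e : (-1 : k) ^ (a + b + 1) = -((-1) ^ (a + 1) * (-1) ^ (b + 1)) := by
    rw [neg_one_pow_eq_of_mod (b := a + 1 + (b + 1) + 1) (by omega), pow_succ, mul_neg_one, pow_add]
  rw [e]
  rcases neg_one_pow_eq_or k (a + 1) with h | h <;>
    rcases neg_one_pow_eq_or k (b + 1) with h' | h' <;> simp only [h, h'] <;> module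

theorem aver_bracket_act (μ : Q.obj 2) (σ : Equiv.Perm (Fin 2)) {a : ℕ} (x : Q.obj a) :
    Q.aver (a + 1) (bracket (Q.act σ μ) a x) = Q.aver (a + 1) (bracket μ a x) := by
  have e1 := aver_preLie_act (Q := Q) (m := 2) (n := a) (r := a + 1) (by omega) σ 1 μ x
  have e2 := aver_preLie_act (Q := Q) (m := a) (n := 2) (r := a + 1) (by omega) 1 σ x μ
  rw [Q.act_one] at e1 e2
  rw [bracket_apply, bracket_apply, map_sub, map_sub, map_smul, map_smul, e1, e2]

/-- After averaging, the bracket with the anti-commutator of `μ` is twice the bracket with `μ`. -/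
theorem dL_anticommutator (μ : Q.obj 2) {a : ℕ} (x : Q.obj a) :
    dL (μ + Q.act (Equiv.swap 0 1) μ) a x = (Q.aver (a + 1) ((2 : k) • bracket μ a x)).1 := by
  have : bracket (μ + Q.act (Equiv.swap 0 1) μ) a x =
      bracket μ a x + bracket (Q.act (Equiv.swap 0 1) μ) a x := by
    simp only [bracket, map_add, LinearMap.sub_apply, LinearMap.smul_apply, LinearMap.sum_apply,
      LinearMap.flip_apply, LinearMap.add_apply, Finset.sum_add_distrib]
    module
  rw [dL_apply, this, map_add, aver_bracket_act, map_smul, two_smul]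

/-- The cup product of an associative `μ` is closed for the bracket with the anti-commutator of
`μ`. -/
theorem isClosedOp_of_assoc [CharZero k] (μ : Q.obj 2)
    (hμ : Q.circ (m := 2) (n := 2) (r := 3) rfl 0 μ μ =
      -Q.circ (m := 2) (n := 2) (r := 3) rfl 1 μ μ) :
    IsClosedOp (μ + Q.act (Equiv.swap 0 1) μ) 2 μ := by
  intro l hl _
  obtain ⟨⟨a, f⟩, ⟨b, g⟩, rfl⟩ := List.length_eq_two.1 hl
  obtain ⟨r, y, hr, hy⟩ := exists_grafts_inj [⟨a, f⟩, ⟨b, g⟩] (p := 0) μ (by simp)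
  obtain rfl : r = a + b := by simp at hr; omega
  have e₁ := averT_grafts_aver [] [⟨b, g⟩] 0 ((2 : k) • bracket μ a f) (Q.inj 2 μ)
  have e₂ := averT_grafts_aver [⟨a, f⟩] [] 0 ((2 : k) • bracket μ b g) (Q.inj 2 μ)
  have e₃ : ∀ (l₁ l₂ : List Q.Elt) (c : ℕ) (z : Q.obj c),
      Q.grafts 0 (l₁ ++ ⟨c, (2 : k) • z⟩ :: l₂) (Q.inj 2 μ) =
        (2 : k) • Q.grafts 0 (l₁ ++ ⟨c, z⟩ :: l₂) (Q.inj 2 μ) := fun l₁ l₂ c z => by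
    simp only [grafts_append, grafts_cons, map_smul]
  rw [e₃] at e₁ e₂
  simp only [leibniz, dE, dL_anticommutator]
  simp only [List.nil_append, List.cons_append] at e₁ e₂
  rw [e₁, e₂, dT_averT, hy, dT_inj, dL_anticommutator, ← averT_inj, map_smul,
    inj_bracket_mul μ hμ f g y hy]
  simp only [map_smul, map_neg, map_add, smul_zero, add_zero]
  rw [show (-1 : k) ^ (2 + 1) = -1 by norm_num]
  module

end Operad

/-! ### Canonical elements -/

section Canonical

variable {k : Type u} [Field k]

/-- Let `w` be a basis of `W` and `w'` a dual family in `D`, for a pairing `B` of `D` with `W`. If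
`q'` kills all elements of `D` that annihilate the kernel of `q`, then the image
of the canonical element `∑ w ⊗ w'` vanishes under `q ⊗ q'`. -/
theorem sum_tmul_dual_eq_zero {W D X Y ι : Type*} [AddCommGroup W] [Module k W] [AddCommGroup D]
    [Module k D] [AddCommGroup X] [Module k X] [AddCommGroup Y] [Module k Y] [Fintype ι]
    (w : Module.Basis ι k W) (B : D →ₗ[k] Module.Dual k W) (w' : ι → D)
    (hw' : ∀ i, B (w' i) = w.coord i) (q : W →ₗ[k] X) (q' : D →ₗ[k] Y)
    (h : ∀ φ, (∀ r, q r = 0 → B φ r = 0) → q' φ = 0) :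
    ∑ i, q (w i) ⊗ₜ[k] q' (w' i) = 0 := by
  classical
  -- a projection along the kernel of `q`
  obtain ⟨g, hg⟩ := q.rangeRestrict.exists_rightInverse_of_surjective q.range_rangeRestrict
  let π : W →ₗ[k] W := g ∘ₗ q.rangeRestrict
  have hπ₀ : ∀ r, q r = 0 → π r = 0 := fun r hr => by
    have : q.rangeRestrict r = 0 := Subtype.ext hr
    rw [LinearMap.comp_apply, this, map_zero]
  have hπ : ∀ r, q (π r) = q r := fun r =>
    congrArg Subtype.val (LinearMap.congr_fun hg (q.rangeRestrict r))
  have h1 : ∀ i, q (w i) = ∑ v, w.coord v (π (w i)) • q (w v) := fun i => by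
    conv_lhs => rw [← hπ, ← w.sum_repr (π (w i)), map_sum]
    simp only [map_smul, Module.Basis.coord_apply]
  have h2 : ∀ v, q' (∑ i, w.coord v (π (w i)) • w' i) = 0 := fun v => h _ fun r hr => by
    have : (B (∑ i, w.coord v (π (w i)) • w' i)) = w.coord v ∘ₗ π := w.ext fun i => by
      simp only [map_sum, map_smul, hw', LinearMap.sum_apply, LinearMap.smul_apply,
        LinearMap.comp_apply, Module.Basis.coord_apply, Module.Basis.repr_self,
        Finsupp.single_apply, smul_eq_mul, mul_ite, mul_one, mul_zero, Finset.sum_ite_eq,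
        Finset.mem_univ, if_true]
    rw [this, LinearMap.comp_apply, hπ₀ r hr, map_zero]
  calc ∑ i, q (w i) ⊗ₜ[k] q' (w' i)
      = ∑ v, q (w v) ⊗ₜ[k] q' (∑ i, w.coord v (π (w i)) • w' i) := by
        conv_lhs => enter [2, i]; rw [h1 i]
        simp only [TensorProduct.sum_tmul, map_sum, map_smul, TensorProduct.tmul_sum,
          TensorProduct.tmul_smul, TensorProduct.smul_tmul']
        exact Finset.sum_comm
    _ = 0 := by simp only [h2, TensorProduct.tmul_zero, Finset.sum_const_zero]

/-- The canonical element of `V ⊗ V^#`, in terms of a family with a dual family. -/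
theorem sum_tmul_eq_coevaluation {V ι : Type u} [AddCommGroup V] [Module k V]
    [FiniteDimensional k V] [Fintype ι] (x : ι → V) (φ : ι → Module.Dual k V)
    (h : ∀ v, ∑ i, φ i v • x i = v) :
    ∑ i, x i ⊗ₜ[k] φ i = coevaluation k V 1 := by
  rw [coevaluation_apply_one]
  classical
  set b := Module.Basis.ofVectorSpace k V
  have e : ∀ i, φ i = ∑ v, φ i (b v) • b.coord v := fun i => b.ext fun v => by
    simp
  calc ∑ i, x i ⊗ₜ[k] φ i = ∑ v, (∑ i, φ i (b v) • x i) ⊗ₜ[k] b.coord v := by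
        conv_lhs => enter [2, i]; rw [e i]
        simp only [TensorProduct.sum_tmul, TensorProduct.tmul_sum, TensorProduct.tmul_smul,
          TensorProduct.smul_tmul']
        exact Finset.sum_comm
    _ = _ := by simp only [h]

theorem NSOperad.Hom.map_quadMap {E : Type u} [AddCommGroup E] [Module k E]
    {Q R : NSOperad k 0} (F : NSOperad.Hom Q R) (g : E →ₗ[k] Q.obj 2)
    (x : (E ⊗[k] E) × (E ⊗[k] E)) :
    F.map 3 (Q.quadMap g x) = R.quadMap (F.map 2 ∘ₗ g) x := by
  have key : ∀ (i : Fin 2) (z : E ⊗[k] E),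
      F.map 3 (TensorProduct.lift (Q.circ (m := 2) (n := 2) (r := 3) rfl i)
        (TensorProduct.map g g z)) =
      TensorProduct.lift (R.circ (m := 2) (n := 2) (r := 3) rfl i)
        (TensorProduct.map (F.map 2 ∘ₗ g) (F.map 2 ∘ₗ g) z) := by
    intro i z
    induction z with
    | zero => simp
    | add a b ha hb => simp only [map_add, ha, hb]
    | tmul a b => simp [F.map_circ]
  simp only [NSOperad.quadMap_apply, map_add, key]

theorem NSOperad.quadMap_dualGen (P' : NSOperad k 0) {φ} (hφ : φ ∈ P'.dualRelations) :
    P'.quadDual.quadMap P'.dualGen φ = 0 := by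
  refine PresObj.ext fun M => ?_
  obtain ⟨f, hf, h⟩ := M.valid
  have e := (NSOperad.presentedLift (V := P'.IsDualModel) M.Q M.g M.valid).map_quadMap P'.dualGen φ
  refine e.trans ?_
  have : ((NSOperad.presentedLift (V := P'.IsDualModel) M.Q M.g M.valid).map 2).comp
      P'.dualGen = f := by
    ext φ; exact (hf φ).symm
  rw [this, h φ hφ]
  rfl

/-- The canonical element of `P' ⊗ P'^!`, before suspension, is associative: the difference of its
two compositions is the image of the canonical element of the free operad in arity three, where
the sign in the pairing accounts for the minus. -/
theorem NSOperad.chi_assoc (P' : NSOperad k 0) [FiniteDimensional k (P'.obj 2)] :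
    (P'.hadamard P'.quadDual).circ (m := 2) (n := 2) (r := 3) rfl 0 P'.chi P'.chi =
      (P'.hadamard P'.quadDual).circ (m := 2) (n := 2) (r := 3) rfl 1 P'.chi P'.chi := by
  classical
  set b := Module.Basis.ofVectorSpace k (P'.obj 2) with hb
  have hχ : P'.chi = ∑ i, b i ⊗ₜ[k] P'.dualGen (b.coord i) := by
    rw [NSOperad.chi, coevaluation_apply_one, map_sum]
    rfl
  have hc : ∀ t : Fin 2, (P'.hadamard P'.quadDual).circ (m := 2) (n := 2) (r := 3) rfl t
      P'.chi P'.chi = (∑ i, ∑ i', P'.circ (m := 2) (n := 2) (r := 3) rfl t (b i) (b i') ⊗ₜ[k]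
        P'.quadDual.circ (m := 2) (n := 2) (r := 3) rfl t (P'.dualGen (b.coord i))
          (P'.dualGen (b.coord i')) : P'.obj 3 ⊗[k] P'.quadDual.obj 3) := by
    intro t
    rw [hχ]
    change TensorProduct.map₂ _ _ _ _ = _
    simp only [map_sum, LinearMap.sum_apply, TensorProduct.map₂_apply_tmul,
      TensorProduct.map_tmul]
    exact Finset.sum_comm
  let E := P'.obj 2
  -- the pairing with the sign of the second input
  let B : ((Module.Dual k E ⊗[k] Module.Dual k E) × (Module.Dual k E ⊗[k] Module.Dual k E)) →ₗ[k]
      Module.Dual k ((E ⊗[k] E) × (E ⊗[k] E)) :=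
    ((LinearMap.fst k (E ⊗[k] E) (E ⊗[k] E)).dualMap ∘ₗ TensorProduct.dualDistrib k E E).coprod
      (-((LinearMap.snd k (E ⊗[k] E) (E ⊗[k] E)).dualMap ∘ₗ TensorProduct.dualDistrib k E E))
  have hB : ∀ φ r, B φ r = TensorProduct.dualDistrib k _ _ φ.1 r.1 -
      TensorProduct.dualDistrib k _ _ φ.2 r.2 := fun φ r => by
    simp [B, sub_eq_add_neg]
  let w := (b.tensorProduct b).prod (b.tensorProduct b)
  have key := sum_tmul_dual_eq_zero w B
    (Sum.elim (fun i => (b.coord i.1 ⊗ₜ b.coord i.2, 0))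
      (fun i => (0, (-1 : k) • (b.coord i.1 ⊗ₜ b.coord i.2)))) (by
      intro i
      refine w.ext fun i' => ?_
      rw [hB]
      rcases i with ⟨i₁, i₂⟩ | ⟨i₁, i₂⟩ <;> rcases i' with ⟨i'₁, i'₂⟩ | ⟨i'₁, i'₂⟩ <;>
        simp [w, Finsupp.single_apply, Module.Basis.prod_apply] <;> split_ifs <;> simp)
    (P'.quadMap LinearMap.id) (P'.quadDual.quadMap P'.dualGen) (by
      intro φ hφ
      refine P'.quadMap_dualGen fun r hr => ?_
      rw [← hB, hφ r hr])
  rw [Fintype.sum_sum_type, Fintype.sum_prod_type, Fintype.sum_prod_type] at key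
  simp only [w, NSOperad.quadMap_apply] at key
  refine (hc 0).trans (Eq.trans ?_ (hc 1).symm)
  refine sub_eq_zero.1 (Eq.trans ?_ key)
  simp [Module.Basis.prod_apply, TensorProduct.tmul_neg]
  exact sub_eq_add_neg _ _

end Canonical

section Cocycles

variable {k : Type u} [Field k]

theorem Operad.signScalar_swap : signScalar k (Equiv.swap 0 1 : Equiv.Perm (Fin 2)) = -1 := by
  rw [signScalar, Equiv.Perm.sign_swap (by decide)]
  simp

section Symmetrization

variable {P' : NSOperad k 0} {P : Operad k 0} {j : NSOperad.Hom P' P.toNSOperad}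

/-- The non-symmetric canonical element is associative in `P ⊗ P^!`, before suspension. -/
theorem nsChi_assoc [FiniteDimensional k (P.obj 2)] (hj : j.IsSymmetrization) :
    (P.hadamard P.quadDual).circ (m := 2) (n := 2) (r := 3) rfl 0 (nsChi hj) (nsChi hj) =
      (P.hadamard P.quadDual).circ (m := 2) (n := 2) (r := 3) rfl 1 (nsChi hj) (nsChi hj) := by
  have := hj.finite 2
  let F := j.hadamard (dualEmbedding hj)
  exact (F.map_circ (m := 2) (n := 2) (r := 3) rfl 0 P'.chi P'.chi).symm.trans <|
    (congrArg (F.map 3) P'.chi_assoc).trans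
      (F.map_circ (m := 2) (n := 2) (r := 3) rfl 1 P'.chi P'.chi)

theorem nsChi_eq_sum [FiniteDimensional k (P.obj 2)] (hj : j.IsSymmetrization)
    [FiniteDimensional k (P'.obj 2)] :
    nsChi hj = (∑ i, j.map 2 (Module.Basis.ofVectorSpace k (P'.obj 2) i) ⊗ₜ[k]
      P.dualGen ((Module.Basis.ofVectorSpace k (P'.obj 2)).coord i ∘ₗ symmProj hj 2) :
        P.obj 2 ⊗[k] P.quadDual.obj 2) := by
  change TensorProduct.map (j.map 2) ((dualEmbedding hj).map 2)
    (TensorProduct.map LinearMap.id P'.dualGen (coevaluation k (P'.obj 2) 1)) = _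
  rw [coevaluation_apply_one]
  simp only [map_sum, TensorProduct.map_tmul]
  rfl

theorem symmProj_act_map (hj : j.IsSymmetrization) (x : P'.obj 2) :
    symmProj hj 2 (P.act (Equiv.swap 0 1) (j.map 2 x)) = 0 := by
  rw [symmProj_act, if_neg (by decide)]

/-- The canonical element `χ` is the anti-commutator of the non-symmetric one, because `P(2)` is
the sum of `P'(2)` and its translate under the transposition. -/
theorem chi_eq_anticommutator [FiniteDimensional k (P.obj 2)] (hj : j.IsSymmetrization) :
    P.chi = nsChi hj + (P.hadamard P.quadDual).susp.act (Equiv.swap 0 1) (nsChi hj) := by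
  have := hj.finite 2
  set b := Module.Basis.ofVectorSpace k (P'.obj 2) with hb
  have hact : (P.hadamard P.quadDual).susp.act (Equiv.swap 0 1) (nsChi hj) =
      (∑ i, P.act (Equiv.swap 0 1) (j.map 2 (b i)) ⊗ₜ[k]
        P.dualGen (b.coord i ∘ₗ symmProj hj 2 ∘ₗ P.act (Equiv.swap 0 1)) :
        P.obj 2 ⊗[k] P.quadDual.obj 2) := by
    change signScalar k (Equiv.swap 0 1 : Equiv.Perm (Fin 2)) • TensorProduct.map
      (P.act (Equiv.swap 0 1)) (P.quadDual.act (Equiv.swap 0 1)) (nsChi hj) = _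
    rw [Operad.signScalar_swap, nsChi_eq_sum hj, map_sum]
    simp only [TensorProduct.map_tmul, P.act_dualGen, TensorProduct.tmul_neg,
      Finset.sum_neg_distrib, neg_smul, one_smul, neg_neg]
    rfl
  rw [hact, nsChi_eq_sum hj]
  have e := sum_tmul_eq_coevaluation (V := P.obj 2)
    (Sum.elim (fun i => j.map 2 (b i)) (fun i => P.act (Equiv.swap 0 1) (j.map 2 (b i))))
    (Sum.elim (fun i => b.coord i ∘ₗ symmProj hj 2)
      (fun i => b.coord i ∘ₗ symmProj hj 2 ∘ₗ P.act (Equiv.swap 0 1))) (by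
    intro v
    obtain ⟨e₀, e₁, rfl⟩ := exists_decomp hj v
    simp only [Fintype.sum_sum_type, Sum.elim_inl, Sum.elim_inr, LinearMap.comp_apply, map_add,
      symmProj_map, symmProj_act_map, ← P.act_mul, Equiv.swap_mul_self, P.act_one, zero_add,
      add_zero, map_zero, Module.Basis.coord_apply, ← map_smul, ← map_sum, b.sum_repr])
  rw [Operad.chi, ← e, Fintype.sum_sum_type, map_add, map_sum, map_sum]
  rfl

end Symmetrization

/-! ### Morphisms from suspended presented operads -/

theorem eq_smul_of_smul_eq {M : Type*} [AddCommGroup M] [Module k M] {s : k} (hs : s * s = 1)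
    {x y : M} (h : s • x = y) : x = s • y := by
  rw [← h, smul_smul, hs, one_smul]

/-- Morphisms out of a suspension, in terms of the compositions before suspension. -/
theorem Operad.Hom.map_susp_circ {P : Operad k 0} {Q : Operad k 1} (F : Operad.Hom P.susp Q)
    {m n r : ℕ} (h : r + 1 = m + n) (i : Fin m) (a : P.obj m) (b : P.obj n) :
    F.map r (P.circ h i a b) =
      (-1 : k) ^ ((i : ℕ) * (n + 1)) • Q.circ h i (F.map m a) (F.map n b) := by
  exact eq_smul_of_smul_eq (by rw [← pow_add, Even.neg_one_pow ⟨_, rfl⟩])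
    (((F.map r).map_smul ((-1 : k) ^ ((i : ℕ) * (n + 1))) (P.circ h i a b)).symm.trans
      (F.map_circ h i a b))

theorem signScalar_mul_self {n : ℕ} (σ : Equiv.Perm (Fin n)) :
    signScalar k σ * signScalar k σ = 1 := by
  rcases Int.units_eq_one_or (Equiv.Perm.sign σ) with h | h <;> simp [signScalar, h]

theorem Operad.Hom.map_susp_act {P : Operad k 0} {Q : Operad k 1} (F : Operad.Hom P.susp Q)
    {n : ℕ} (σ : Equiv.Perm (Fin n)) (a : P.obj n) :
    F.map n (P.act σ a) = signScalar k σ • Q.act σ (F.map n a) := by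
  exact eq_smul_of_smul_eq (signScalar_mul_self σ)
    (((F.map n).map_smul (signScalar k σ) (P.act σ a)).symm.trans (F.map_act σ a))

variable {G : Type u} {V : ∀ Q : Operad k 0, (G → Q.obj 2) → Prop}

/-- A morphism from the suspension of a presented operad is determined by its values on
generators. -/
theorem Operad.susp_presented_hom_ext {Q : Operad k 1}
    {F F' : Operad.Hom (Operad.presented G V).susp Q}
    (h : ∀ x : G, F.map 2 ((Operad.presented G V).toSusp (Operad.presentedGen x)) =
      F'.map 2 ((Operad.presented G V).toSusp (Operad.presentedGen x))) : F = F' := by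
  have key : ∀ (n : ℕ) (a : OpTerm k G True n),
      F.map n ((PresObj.mk a : (Operad.presented G V).obj n)) =
        F'.map n ((PresObj.mk a : (Operad.presented G V).obj n)) := by
    intro n a
    induction a with
    | gen x => exact h x
    | one => exact F.map_one.trans F'.map_one.symm
    | circ h i a b ha hb =>
      have e := F.map_susp_circ h i (PresObj.mk a) (PresObj.mk b)
      have e' := F'.map_susp_circ h i (PresObj.mk a) (PresObj.mk b)
      rw [ha, hb] at e
      exact e.trans e'.symm
    | act _ σ a ha =>
      have e := F.map_susp_act σ (PresObj.mk a)
      have e' := F'.map_susp_act σ (PresObj.mk a)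
      rw [ha] at e
      exact e.trans e'.symm
    | zero => exact ((F.map _).map_zero).trans ((F'.map _).map_zero).symm
    | add a b ha hb =>
      exact ((F.map _).map_add _ _).trans ((congrArg₂ (· + ·) ha hb).trans
        ((F'.map _).map_add _ _).symm)
    | smul s a ha =>
      exact ((F.map _).map_smul _ _).trans ((congrArg (s • ·) ha).trans
        ((F'.map _).map_smul _ _).symm)
  refine Operad.Hom.ext ?_
  funext n
  refine LinearMap.ext fun x => ?_
  induction x using Quotient.inductionOn with
  | h a => exact key n a

/-- A morphism whose image is contained in a suboperad. -/
def Operad.Hom.codRestrict {c : ℕ} {P Q : Operad k c} (F : Operad.Hom P Q) (Z : Q.Suboperad)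
    (h : ∀ n x, F.map n x ∈ Z.carrier n) : Operad.Hom P Z.toOperad where
  map n := (F.map n).codRestrict (Z.carrier n) (h n)
  map_one := Subtype.ext F.map_one
  map_circ h i a b := Subtype.ext (F.map_circ h i a b)
  map_act σ a := Subtype.ext (F.map_act σ a)

/-- The image of a presented operad lies in a suboperad of the suspension if that of the generators
does, because the structures before and after suspension differ by signs only. -/
theorem Operad.presented_map_mem {Q : Operad k 0} (Z : Q.susp.Suboperad)
    (F : Operad.Hom (Operad.presented G V) Q)
    (h : ∀ x : G, F.map 2 (Operad.presentedGen x) ∈ Z.carrier 2) (n : ℕ)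
    (x : (Operad.presented G V).obj n) : F.susp.map n x ∈ Z.carrier n := by
  have tr : ∀ {n : ℕ} {x y : Q.obj n}, x = y → y ∈ Z.carrier n → x ∈ Z.carrier n :=
    fun e h => e ▸ h
  have key : ∀ (n : ℕ) (a : OpTerm k G True n),
      F.susp.map n ((PresObj.mk a : (Operad.presented G V).obj n)) ∈ Z.carrier n := by
    intro n a
    induction a with
    | gen x => exact h x
    | one => exact tr F.map_one Z.one_mem
    | circ h i a b ha hb =>
      exact tr (F.susp.map_susp_circ h i (PresObj.mk a) (PresObj.mk b))
        (Submodule.smul_mem _ _ (Z.circ_mem h i _ _ ha hb))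
    | act _ σ a ha =>
      exact tr (F.susp.map_susp_act σ (PresObj.mk a))
        (Submodule.smul_mem _ _ (Z.act_mem σ _ ha))
    | zero => exact tr (F.susp.map _).map_zero (Submodule.zero_mem _)
    | add a b ha hb =>
      exact tr ((F.susp.map _).map_add (PresObj.mk a) (PresObj.mk b)) (Submodule.add_mem _ ha hb)
    | smul s a ha =>
      exact tr ((F.susp.map _).map_smul s (PresObj.mk a)) (Submodule.smul_mem _ _ ha)
  induction x using Quotient.inductionOn with
  | h a => exact key n a

/-- The commutator of an associative product is a Lie bracket. -/
theorem lieRelation_commutator (Q : Operad k 0) (μ : Q.obj 2)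
    (hμ : Q.circ (m := 2) (n := 2) (r := 3) rfl 0 μ μ =
      Q.circ (m := 2) (n := 2) (r := 3) rfl 1 μ μ) :
    lieRelation Q fun _ => μ - Q.act (Equiv.swap 0 1) μ := by
  constructor
  · rw [map_sub, ← Q.act_mul, Equiv.swap_mul_self, Q.act_one, neg_sub]
  have key : ∀ (σ τ : Equiv.Perm (Fin 2)) (ρ : Equiv.Perm (Fin 3)), IsBlockPerm 0 σ τ ρ →
      Q.circ (m := 2) (n := 2) (r := 3) rfl 0 (Q.act σ μ) (Q.act τ μ) =
        Q.act ρ (Q.circ (m := 2) (n := 2) (r := 3) rfl 0 μ μ) := by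
    intro σ τ ρ H
    rw [Q.circ_act _ 0 σ τ ρ H]
    obtain h | h : σ 0 = 0 ∨ σ 0 = 1 := by omega
    · rw [h]
    · rw [h, hμ]
  have k2 := key 1 (Equiv.swap 0 1) (Equiv.swap 0 1) (by unfold IsBlockPerm; decide)
  have k3 := key (Equiv.swap 0 1) 1 (finRotate 3) (by unfold IsBlockPerm; decide)
  have k4 := key (Equiv.swap 0 1) (Equiv.swap 0 1) (Equiv.swap 0 2)
    (by unfold IsBlockPerm; decide)
  rw [Q.act_one] at k2 k3
  set T := Q.circ (m := 2) (n := 2) (r := 3) rfl 0 μ μ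
  simp only [map_sub, LinearMap.sub_apply, k2, k3, k4, ← Q.act_mul, Fin.sum_univ_three]
  have p₀ : finRotate 3 ^ ((0 : Fin 3) : ℕ) = 1 := by decide
  have p₁ : finRotate 3 ^ ((1 : Fin 3) : ℕ) = finRotate 3 := by decide
  have p₂ : finRotate 3 ^ ((2 : Fin 3) : ℕ) = finRotate 3 * finRotate 3 := by decide
  have q₁ : finRotate 3 * (finRotate 3 * finRotate 3) = 1 := by decide
  have q₂ : (Equiv.swap 0 2 : Equiv.Perm (Fin 3)) = Equiv.swap 0 1 * (finRotate 3 * finRotate 3) := by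
    decide
  have q₃ : (Equiv.swap 0 2 : Equiv.Perm (Fin 3)) * finRotate 3 = Equiv.swap 0 1 := by decide
  have q₄ : (Equiv.swap 0 2 : Equiv.Perm (Fin 3)) * (finRotate 3 * finRotate 3) =
      Equiv.swap 0 1 * finRotate 3 := by decide
  rw [p₀, p₁, p₂, q₁, q₃, q₄, q₂]
  simp only [mul_one]
  abel

theorem Ass.mu_assoc (k : Type u) [Field k] :
    (Ass k).circ (m := 2) (n := 2) (r := 3) rfl 0 (Ass.mu k) (Ass.mu k) =
      (Ass k).circ (m := 2) (n := 2) (r := 3) rfl 1 (Ass.mu k) (Ass.mu k) :=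
  PresObj.ext fun M => M.valid

/-! ### The suboperad of cocycles -/

/-- Cocycles, in terms of closed operations in the coefficient operads of all algebras. -/
theorem Operad.isCocycle_iff {P : Operad k 0} [FiniteDimensional k (P.obj 2)] {n : ℕ}
    (t : (P.hadamard P.quadDual).susp.obj n) : P.IsCocycle t ↔
      ∀ (A : Type u) [AddCommGroup A] [Module k A] (α : Operad.Hom P (endOperad k A)),
        Operad.IsClosedOp ((algMap α).map 2 P.chi) n ((algMap α).map n t) := by
  simp only [Operad.isClosedOp_iff]
  rfl

/-- The suboperad `𝒵_P` of cocycles of `s(P ⊗ P^!)`. -/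
def Operad.cocycles [CharZero k] (P : Operad k 0) [FiniteDimensional k (P.obj 2)] :
    (P.hadamard P.quadDual).susp.Suboperad where
  carrier n :=
    { carrier := {t | P.IsCocycle t}
      zero_mem' := (Operad.isCocycle_iff _).2 fun A _ _ α => by
        rw [map_zero]
        exact Operad.isClosedOp_zero _ n
      add_mem' := fun ha hb => (Operad.isCocycle_iff _).2 fun A _ _ α => by
        rw [map_add]
        exact Operad.isClosedOp_add ((Operad.isCocycle_iff _).1 ha A α)
          ((Operad.isCocycle_iff _).1 hb A α)
      smul_mem' := fun s _ ha => (Operad.isCocycle_iff _).2 fun A _ _ α => by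
        rw [map_smul]
        exact Operad.isClosedOp_smul s ((Operad.isCocycle_iff _).1 ha A α) }
  one_mem := (Operad.isCocycle_iff _).2 fun A _ _ α => by
    rw [(algMap α).map_one]
    exact Operad.isClosedOp_one _
  circ_mem h i a b ha hb := (Operad.isCocycle_iff _).2 fun A _ _ α => by
    rw [(algMap α).map_circ]
    exact Operad.isClosedOp_circ h i ((Operad.isCocycle_iff _).1 ha A α)
      ((Operad.isCocycle_iff _).1 hb A α)
  act_mem σ a ha := (Operad.isCocycle_iff _).2 fun A _ _ α => by
    rw [(algMap α).map_act]
    exact Operad.isClosedOp_act σ ((Operad.isCocycle_iff _).1 ha A α)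

/-- Associativity becomes anti-associativity under suspension. -/
theorem Operad.susp_assoc (R : Operad k 0) (μ : R.obj 2)
    (hμ : R.circ (m := 2) (n := 2) (r := 3) rfl 0 μ μ =
      R.circ (m := 2) (n := 2) (r := 3) rfl 1 μ μ) :
    R.susp.circ (m := 2) (n := 2) (r := 3) rfl 0 (R.toSusp μ) (R.toSusp μ) =
      -R.susp.circ (m := 2) (n := 2) (r := 3) rfl 1 (R.toSusp μ) (R.toSusp μ) := by
  have e : ((-1 : k) ^ (0 * (2 + 1)) • R.circ (m := 2) (n := 2) (r := 3) rfl 0 μ μ : R.obj 3) =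
      -((-1 : k) ^ (1 * (2 + 1)) • R.circ (m := 2) (n := 2) (r := 3) rfl 1 μ μ) := by
    rw [hμ]
    norm_num
  exact e

/-- The image `μ` of the non-symmetric canonical element in the coefficients is anti-associative and
`χ` is its anti-commutator, so its cup product is closed for the bracket with `χ`. -/
theorem isCocycle_nsChi [CharZero k] {P' : NSOperad k 0} {P : Operad k 0}
    {j : NSOperad.Hom P' P.toNSOperad} [FiniteDimensional k (P.obj 2)]
    (hj : j.IsSymmetrization) : P.IsCocycle (nsChi hj) := by
  refine (Operad.isCocycle_iff _).2 fun A _ _ α => ?_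
  rw [chi_eq_anticommutator hj, map_add, (algMap α).map_act]
  refine Operad.isClosedOp_of_assoc _ ?_
  have e := Operad.susp_assoc (P.hadamard P.quadDual) (nsChi hj) (nsChi_assoc hj)
  rw [← (algMap α).map_circ, ← (algMap α).map_circ]
  exact (congrArg ((algMap α).map 3) e).trans (map_neg _ _)

end Cocycles

theorem mainTheorem9 {k : Type u} [Field k] [CharZero k] (P' : NSOperad k 0) (P : Operad k 0)
    (j : NSOperad.Hom P' P.toNSOperad) (hj : j.IsSymmetrization)
    [FiniteDimensional k (P.obj 2)] :
    ∃ Z : (P.hadamard P.quadDual).susp.Suboperad,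
      (∀ (n : ℕ) (t : (P.hadamard P.quadDual).susp.obj n), t ∈ Z.carrier n ↔ P.IsCocycle t) ∧
      ∃ (hχ' : nsChi hj ∈ Z.carrier 2) (hχ : P.chi ∈ Z.carrier 2),
        (∃! A : Operad.Hom (Ass k).susp Z.toOperad, A.map 2 ((Ass k).toSusp (Ass.mu k)) = ⟨nsChi hj, hχ'⟩) ∧
        (∃! L : Operad.Hom (Lie k).susp Z.toOperad, L.map 2 ((Lie k).toSusp (Lie.lam k)) = ⟨P.chi, hχ⟩) ∧
        (∃! c : Operad.Hom (Lie k).susp (Ass k).susp,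
          c.map 2 ((Lie k).toSusp (Lie.lam k)) =
            (Ass k).toSusp (Ass.mu k) +
              (Ass k).susp.act (Equiv.swap 0 1) ((Ass k).toSusp (Ass.mu k))) ∧
        ∀ (A : Operad.Hom (Ass k).susp Z.toOperad) (L : Operad.Hom (Lie k).susp Z.toOperad)
          (c : Operad.Hom (Lie k).susp (Ass k).susp),
          A.map 2 ((Ass k).toSusp (Ass.mu k)) = ⟨nsChi hj, hχ'⟩ → L.map 2 ((Lie k).toSusp (Lie.lam k)) = ⟨P.chi, hχ⟩ →
          c.map 2 ((Lie k).toSusp (Lie.lam k)) =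
            (Ass k).toSusp (Ass.mu k) +
              (Ass k).susp.act (Equiv.swap 0 1) ((Ass k).toSusp (Ass.mu k)) →
          L = A.comp c := by
  have hχ' : nsChi hj ∈ P.cocycles.carrier 2 := isCocycle_nsChi hj
  have hχ : P.chi ∈ P.cocycles.carrier 2 := by
    rw [chi_eq_anticommutator hj]
    exact add_mem hχ' (P.cocycles.act_mem _ _ hχ')
  -- `A` on the unsuspended operads
  let A₀ : Operad.Hom (Ass k) (P.hadamard P.quadDual) :=
    Operad.presentedLift (V := assRelation) _ (fun _ => nsChi hj) (nsChi_assoc hj)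
  let A := A₀.susp.codRestrict P.cocycles (Operad.presented_map_mem _ A₀ fun _ => hχ')
  have hA : A.map 2 ((Ass k).toSusp (Ass.mu k)) = ⟨nsChi hj, hχ'⟩ := rfl
  let c := (Operad.presentedLift (V := lieRelation) (Ass k)
    (fun _ => Ass.mu k - (Ass k).act (Equiv.swap 0 1) (Ass.mu k))
    (lieRelation_commutator _ _ (Ass.mu_assoc k))).susp
  have hc : c.map 2 ((Lie k).toSusp (Lie.lam k)) = (Ass k).toSusp (Ass.mu k) +
      (Ass k).susp.act (Equiv.swap 0 1) ((Ass k).toSusp (Ass.mu k)) := by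
    change Ass.mu k - (Ass k).act (Equiv.swap 0 1) (Ass.mu k) = Ass.mu k +
      signScalar k (Equiv.swap 0 1 : Equiv.Perm (Fin 2)) • (Ass k).act (Equiv.swap 0 1) (Ass.mu k)
    rw [Operad.signScalar_swap, neg_smul, one_smul, sub_eq_add_neg]
  have hAc : ∀ (A : Operad.Hom (Ass k).susp P.cocycles.toOperad)
      (c : Operad.Hom (Lie k).susp (Ass k).susp),
      A.map 2 ((Ass k).toSusp (Ass.mu k)) = ⟨nsChi hj, hχ'⟩ →
      c.map 2 ((Lie k).toSusp (Lie.lam k)) = (Ass k).toSusp (Ass.mu k) +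
        (Ass k).susp.act (Equiv.swap 0 1) ((Ass k).toSusp (Ass.mu k)) →
      (A.comp c).map 2 ((Lie k).toSusp (Lie.lam k)) = ⟨P.chi, hχ⟩ := by
    intro A c hA hc
    change A.map 2 (c.map 2 _) = _
    rw [hc, map_add, A.map_act, hA]
    exact Subtype.ext (chi_eq_anticommutator hj).symm
  refine ⟨P.cocycles, fun _ _ => Iff.rfl, hχ', hχ, ⟨A, hA, fun A' hA' => ?_⟩,
    ⟨A.comp c, hAc A c hA hc, fun L hL => ?_⟩, ⟨c, hc, fun c' hc' => ?_⟩, fun A' L c' hA' hL hc' => ?_⟩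
  · exact Operad.susp_presented_hom_ext fun _ => hA'.trans hA.symm
  · exact Operad.susp_presented_hom_ext fun _ => hL.trans (hAc A c hA hc).symm
  · exact Operad.susp_presented_hom_ext fun _ => hc'.trans hc.symm
  · exact Operad.susp_presented_hom_ext fun _ => hL.trans (hAc A' c' hA' hc').symm
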